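/- **Setting.** Let $\mathbb T=\mathbb R/\mathbb Z$ and let $\|v-w\|$ be the flat (Euclidean) distance on $\mathbb T^2$. Let $T(x,y)=(x+a,y+b)$ be a minimal rotation of $\mathbb T^2$ and $z_0\in\mathbb T^2$; put $z_{2n}=T^nz_0$, $z_{2n+1}=T^{-n-1}z_0$, $z_n=(x_n,y_n)$, let $\sigma,\tau:\mathbb N\to\mathbb N$ be the bijections with $Tz_n=z_{\sigma(n)}$, $T^{-1}z_n=z_{\tau(n)}$, and let $X=(\mathbb T\setminus\{x_n:n\in\mathbb N\})\times\mathbb T$. Fix a strictly decreasing sequence $1=\epsilon_0>\epsilon_1>\cdots\to0$, numbers $\epsilon_{k+1}<e^1_k<e^2_k<e^3_k<\epsilon_k$, and a sequence $(q_k)$ dense in $[0,1]$. For $\alpha\in[0,1]^{\mathbb N}$ let $p_\alpha:(0,1]\to[0,\frac14]$ be the continuous function with $p_\alpha(1)=\frac14$; $p_\alpha=q_0/4$ on $[\epsilon_1,e^1_0]$ and $p_\alpha=\alpha(0)/4$ on $[e^2_0,e^3_0]$; for $k\ge1$, $p_\alpha=\alpha(k)/4$ on $[\epsilon_{k+1},e^1_k]$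 and $p_\alpha=q_k/4$ on $[e^2_k,e^3_k]$; and $p_\alpha$ affine on each $[e^1_k,e^2_k]$ and $[e^3_k,\epsilon_k]$. For $0<t\le1$ let $h^\alpha_t:[-1,1]\to[-1,1]$ be the function whose graph is the polyline through $$(-1,-1),\ \left(-\tfrac{1+t}2,-t\right),\ \left(-\tfrac12,-\tfrac t2\right),\ \left(p_\alpha(t),\tfrac t4\right),\ \left(\tfrac12,\tfrac t2\right),\ \left(\tfrac{1+t}2,t\right),\ (1,1),$$ let $h^\alpha_{-t}=h^\alpha_t$, and let $h^\alpha_0$ be given by the polyline through $(-1,-1),(-\frac12,0),(\frac12,0),(1,1)$. For a sequence $\delta_n>0$ let $A_n=\{z_n+(t,s):|t|,|s|\le\delta_n\}$, let $\Lambda_n$ be the identity off $A_n$ and $\Lambda_n(z_n+(t,s))=z_n+\bigl(t,h^\alpha_t((h^\alpha_{\delta_n})^{-1}(s))\bigr)$ on $A_n$, and put $$\Phi_n=\Lambda_n\circ\cdots\circ\Lambda_0,\qquad \Phi^\sigma_n=\Lambda_{\sigma(n)}\circ\cdots\circ\Lambda_{\sigma(0)},\qquad \Phi^\tau_n=\Lambda_{\tau(n)}\circ\cdots\circ\Lambda_{\tau(0)}.$$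 **Theorem.** For every $\alpha\in[0,1]^{\mathbb N}$ there are integers $a_n\ge2$ with $\prod_{n\ge1}(1-1/a_n)>0$ and positive thresholds $\epsilon_{1,n},\epsilon_{2,n},\epsilon_{3,n}$ such that, whenever $\operatorname{Diam}(A_n)<\epsilon_{i,n}$ for all $n$ and $i=1,2,3$, the following hold. 1. If $m>n\ge1$ and $\|v-w\|\ge1/n$, then $\|\Phi_m(v)-\Phi_m(w)\|\ge\prod_{r=n+1}^m(1-1/a_r)\,\|\Phi_n(v)-\Phi_n(w)\|$. 2. $\Phi_n,\Phi^\sigma_n,\Phi^\tau_n$ restrict to bijections of $X$; all maps $(\Phi^\sigma_n)^{-1}\circ T\circ\Phi_n$ and $(\Phi^\tau_n)^{-1}\circ T^{-1}\circ\Phi_n$ are uniformly continuous on $X$, and each of these two sequences is uniformly Cauchy on $X$. 3. $\Phi_n$ converges uniformly to a continuous surjection $\Phi_\alpha:\mathbb T^2\to\mathbb T^2$, which preserves the first coordinate and restricts to a bijection of $X$; the fibre $\Phi_\alpha^{-1}(\{z\})$ fails to be a singleton if and only if $z=z_n$ for some $n$. 4. The map $\Phi_\alpha^{-1}\circ T\circ\Phi_\alpha$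 on $X$ extends uniquely to a homeomorphism $S_\alpha$ of $\mathbb T^2$, and $\Phi_\alpha\circ S_\alpha=T\circ\Phi_\alpha$ on $\mathbb T^2$. On $X$, $S_\alpha$ and $S_\alpha^{-1}$ are the uniform limits of the two sequences in 2. -/

import Mathlib

open Set Filter Topology

noncomputable section

namespace DenjoyRees

/-! ### The torus, rotations, and the enumeration of an orbit -/

/-- The torus `𝕋² = (ℝ/ℤ)²`. -/
abbrev Torus : Type := UnitAddCircle × UnitAddCircle

/-- The usual (flat, Euclidean) distance on the torus. It induces the same uniformity as the
product metric of Mathlib. -/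
def flatDist (v w : Torus) : ℝ := Real.sqrt (dist v.1 w.1 ^ 2 + dist v.2 w.2 ^ 2)

/-- The diameter of a subset of the torus for the flat distance (distances are bounded, so the
supremum is a genuine one for non-empty sets). -/
def flatDiam (A : Set Torus) : ℝ := sSup {r | ∃ v ∈ A, ∃ w ∈ A, r = flatDist v w}

/-- The rotation `T (x, y) = (x + a, y + b)`, where `c = (a, b)`. -/
def rot (c : Torus) : Torus ≃ₜ Torus := Homeomorph.addRight c

/-- A homeomorphism is minimal if each of its (two-sided) orbits is dense. -/
def IsMinimalHomeo (f : Torus ≃ₜ Torus) : Prop :=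
  ∀ w : Torus, Dense (range fun k : ℤ => (f ^ k) w)

/-- The exponents `0, -1, 1, -2, 2, …`. -/
def orbitIndex (n : ℕ) : ℤ := if Even n then ((n / 2 : ℕ) : ℤ) else -(((n + 1) / 2 : ℕ) : ℤ)

/-- `z_{2n} = T^n z₀` and `z_{2n+1} = T^{-n-1} z₀`. -/
def orbitPt (c z₀ : Torus) (n : ℕ) : Torus := (rot c ^ orbitIndex n) z₀

/-- The bijection of `ℕ` with `T z_n = z_{σ n}`. -/
def sigma (n : ℕ) : ℕ := if Even n then n + 2 else if n = 1 then 0 else n - 2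

/-- The bijection of `ℕ` with `T⁻¹ z_n = z_{τ n}`. -/
def tau (n : ℕ) : ℕ := if Even n then (if n = 0 then 1 else n - 2) else n + 2

lemma orbitIndex_sigma (n : ℕ) : orbitIndex (sigma n) = 1 + orbitIndex n := by
  unfold orbitIndex sigma
  grind

lemma orbitIndex_tau (n : ℕ) : orbitIndex (tau n) = -1 + orbitIndex n := by
  unfold orbitIndex tau
  grind

lemma rot_orbitPt (c z₀ : Torus) (n : ℕ) :
    rot c (orbitPt c z₀ n) = orbitPt c z₀ (sigma n) := by
  unfold orbitPt
  rw [orbitIndex_sigma, zpow_add, zpow_one]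
  rfl

lemma rot_symm_orbitPt (c z₀ : Torus) (n : ℕ) :
    (rot c).symm (orbitPt c z₀ n) = orbitPt c z₀ (tau n) := by
  unfold orbitPt
  rw [orbitIndex_tau, zpow_add, zpow_neg, zpow_one]
  rfl

/-- `X = (𝕋 \ {x_n : n ∈ ℕ}) × 𝕋`, where `z_n = (x_n, y_n)`. -/
def goodSet (c z₀ : Torus) : Set Torus := {w | ∀ n, w.1 ≠ (orbitPt c z₀ n).1}

/-- The closed square with centre `z` and side length `2 * δ`. -/
def square (z : Torus) (δ : ℝ) : Set Torus :=
  {w | ∃ t s : ℝ, |t| ≤ δ ∧ |s| ≤ δ ∧ w = (z.1 + (t : UnitAddCircle), z.2 + (s : UnitAddCircle))}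

/-! ### The functions `p_α` and `h^α` -/

/-- The affine function whose graph passes through `(x₀, y₀)` and `(x₁, y₁)`. -/
def seg (x₀ y₀ x₁ y₁ u : ℝ) : ℝ := y₀ + (y₁ - y₀) / (x₁ - x₀) * (u - x₀)

/-- The auxiliary choices that are fixed once and for all: a sequence `1 = ε_0 > ε_1 > …`
tending to `0`, a division `ε_{k+1} < e¹_k < e²_k < e³_k < ε_k` of each interval
`[ε_{k+1}, ε_k]` into four strips, and a sequence `q` that is dense in `[0, 1]`. -/
structure StripData where
  eps : ℕ → ℝ
  eps_zero : eps 0 = 1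
  eps_strictAnti : StrictAnti eps
  eps_tendsto : Tendsto eps atTop (𝓝 0)
  e1 : ℕ → ℝ
  e2 : ℕ → ℝ
  e3 : ℕ → ℝ
  eps_lt_e1 : ∀ k, eps (k + 1) < e1 k
  e1_lt_e2 : ∀ k, e1 k < e2 k
  e2_lt_e3 : ∀ k, e2 k < e3 k
  e3_lt_eps : ∀ k, e3 k < eps k
  q : ℕ → ℝ
  q_mem : ∀ k, q k ∈ Icc (0 : ℝ) 1
  q_dense : Icc (0 : ℝ) 1 ⊆ closure (range q)

variable (D : StripData) (α : ℕ → ℝ)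

/-- The constant value of `p_α` on the first strip `[ε_{k+1}, e¹_k]`. -/
def lowVal (k : ℕ) : ℝ := if k = 0 then D.q 0 / 4 else α k / 4

/-- The constant value of `p_α` on the third strip `[e²_k, e³_k]`. -/
def highVal (k : ℕ) : ℝ := if k = 0 then α 0 / 4 else D.q k / 4

/-- The value of `p_α` at `ε_k`. -/
def topVal (k : ℕ) : ℝ := if k = 0 then 1 / 4 else lowVal D α (k - 1)

/-- `p_α` on `[ε_{k+1}, ε_k]`: constant on the first and the third strip, affine on the second
and the fourth. -/
def stripVal (k : ℕ) (t : ℝ) : ℝ :=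
  if t ≤ D.e1 k then lowVal D α k
  else if t ≤ D.e2 k then seg (D.e1 k) (lowVal D α k) (D.e2 k) (highVal D α k) t
  else if t ≤ D.e3 k then highVal D α k
  else seg (D.e3 k) (highVal D α k) (D.eps k) (topVal D α k) t

open Classical in
/-- The function `p_α` on `(0, 1]`: the `k` that is found is the one with
`ε_{k+1} < t ≤ ε_k`. (The value at `t ≤ 0` is irrelevant.) -/
def pFun (t : ℝ) : ℝ :=
  if h : ∃ k, D.eps (k + 1) < t then stripVal D α (Nat.find h) t else 0

/-- The polyline through `(-1, -1)`, `(-(1+t)/2, -t)`, `(-1/2, -t/2)`, `(p, t/4)`,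
`(1/2, t/2)`, `((1+t)/2, t)`, `(1, 1)`. For `t = 0` this is the polyline through
`(-1, -1)`, `(-1/2, 0)`, `(1/2, 0)`, `(1, 1)`. -/
def polyline (p t u : ℝ) : ℝ :=
  if u ≤ -(1 + t) / 2 then seg (-1) (-1) (-(1 + t) / 2) (-t) u
  else if u ≤ -(1 / 2) then seg (-(1 + t) / 2) (-t) (-(1 / 2)) (-t / 2) u
  else if u ≤ p then seg (-(1 / 2)) (-t / 2) p (t / 4) u
  else if u ≤ 1 / 2 then seg p (t / 4) (1 / 2) (t / 2) u
  else if u ≤ (1 + t) / 2 then seg (1 / 2) (t / 2) ((1 + t) / 2) t u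
  else seg ((1 + t) / 2) t 1 1 u

/-- The map `h^α_t : [-1, 1] → [-1, 1]`, with `h^α_{-t} = h^α_t`. -/
def hMap (t u : ℝ) : ℝ := polyline (pFun D α |t|) |t| u

/-- The inverse of the bijection `h^α_t : [-1, 1] → [-1, 1]`, for `0 < |t| ≤ 1`. -/
def hInv (t : ℝ) : ℝ → ℝ := Function.invFunOn (hMap D α t) (Icc (-1) 1)

/-! ### The maps `Λ` and `Φ` -/

/-- The representative in `[-1/2, 1/2)` of a point of the circle. -/
def rep (θ : UnitAddCircle) : ℝ := (AddCircle.equivIco (1 : ℝ) (-1 / 2) θ : ℝ)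

open Classical in
/-- `Λ (x + t, y + s) = (x + t, y + h^α_t ((h^α_δ)⁻¹ s))` for `|t|, |s| ≤ δ`, where
`z = (x, y)`, and `Λ` is the identity outside the square with centre `z` and side `2 * δ`. -/
def lam (z : Torus) (δ : ℝ) (w : Torus) : Torus :=
  if w ∈ square z δ then
    (w.1, z.2 + ((hMap D α (rep (w.1 - z.1)) (hInv D α δ (rep (w.2 - z.2))) : ℝ) : UnitAddCircle))
  else w

/-- The composition `L n ∘ L (n - 1) ∘ ⋯ ∘ L 0`. -/
def compUpTo (L : ℕ → Torus → Torus) : ℕ → Torus → Torus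
  | 0 => L 0
  | n + 1 => L (n + 1) ∘ compUpTo L n

variable (c z₀ : Torus) (δ : ℕ → ℝ)

/-- `Λ_{α,n}`, supported on the square `A_{α,n}` with centre `z_n` and side `2 * δ n`. -/
def lamSeq (n : ℕ) : Torus → Torus := lam D α (orbitPt c z₀ n) (δ n)

/-- `Φ_{α,n} = Λ_{α,n} ∘ ⋯ ∘ Λ_{α,0}`. -/
def phi (n : ℕ) : Torus → Torus := compUpTo (lamSeq D α c z₀ δ) n

/-- `Φ^σ_{α,n} = Λ_{α,σ(n)} ∘ ⋯ ∘ Λ_{α,σ(0)}`. -/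
def phiSigma (n : ℕ) : Torus → Torus := compUpTo (fun k => lamSeq D α c z₀ δ (sigma k)) n

/-- `Φ^τ_{α,n} = Λ_{α,τ(n)} ∘ ⋯ ∘ Λ_{α,τ(0)}`. -/
def phiTau (n : ℕ) : Torus → Torus := compUpTo (fun k => lamSeq D α c z₀ δ (tau k)) n

/-- `G⁻¹ ∘ R ∘ F` on `X`, where `G⁻¹` is the inverse of the bijection `G : X → X`. -/
def conjOn (X : Set Torus) (G R F : Torus → Torus) (w : Torus) : Torus :=
  Function.invFunOn G X (R (F w))

end DenjoyRees

end

open DenjoyRees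

/-!
In the coordinate `u` in which the fibre over `x` is parametrized by `h^α_r`, the map `Λ_n` only
replaces the radius `δ_n` by `min ‖x - x_n‖ δ_n`. So it collapses one segment of the fibre over
`x_n` to `z_n`, is injective elsewhere, and its inverse has, away from that fibre, a modulus of
continuity that depends neither on `z_n` nor on `δ_n`.

Because of this uniformity the thresholds can be chosen in terms of the centres alone: for
`v`, `w` at distance at least `1 / n`, one of which is moved by `Λ_n`, the distance between
`Φ_{n-1}(v)` and `Φ_{n-1}(w)` is bounded below, so a small `δ_n` hardly changes it. With
`a_n = (n + 2) ^ 2` the product of the contraction factors telescopes and stays above `2 / 3`. Hence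
`Φ` identifies two points only if some `Φ_n` already does, and then their common image is a centre.

Members `Λ_n` with neighbouring indices have disjoint supports and commute, so `Φ^σ_n` differs
from `Φ_n` only in its last few factors and has the same limit. By translation invariance
`(Φ^σ_n)⁻¹ ∘ T ∘ Φ_n` is `T` composed with `(Φ'_n)⁻¹ ∘ Φ_n`, where `Φ'` has the same centres as
`Φ` but the sizes `δ_{σ(n)}`. The change of size `Λ_{z,δ'}⁻¹ ∘ Λ_{z,δ}` again preserves the
coordinate `u` near the fibre of `z`, hence is uniformly continuous off that fibre, and small
sizes make the sequence geometrically Cauchy. The limits for `T` and `T⁻¹` are semiconjugate to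
them by `Φ`, which is injective on the dense set `X`, so they are inverse to each other.
-/

noncomputable section

namespace DenjoyRees

/-! ### The function `p_α` -/

section PFun

lemma seg_eq_lineMap (x₀ y₀ x₁ y₁ u : ℝ) :
    seg x₀ y₀ x₁ y₁ u = AffineMap.lineMap y₀ y₁ ((u - x₀) / (x₁ - x₀)) := by
  rw [seg, AffineMap.lineMap_apply_ring']
  ring

lemma continuous_seg (x₀ y₀ x₁ y₁ : ℝ) : Continuous (seg x₀ y₀ x₁ y₁) := by
  unfold seg
  fun_prop

lemma seg_left (x₀ y₀ x₁ y₁ : ℝ) : seg x₀ y₀ x₁ y₁ x₀ = y₀ := by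
  simp [seg]

lemma seg_right {x₀ x₁ : ℝ} (h : x₀ < x₁) (y₀ y₁ : ℝ) : seg x₀ y₀ x₁ y₁ x₁ = y₁ := by
  rw [seg_eq_lineMap, div_self (sub_pos.2 h).ne', AffineMap.lineMap_apply_one]

lemma seg_eq_of_slope {x₀ x₁ y₀ y₁ m : ℝ} (h : x₀ < x₁) (hm : y₁ - y₀ = m * (x₁ - x₀)) (u : ℝ) :
    seg x₀ y₀ x₁ y₁ u = y₀ + m * (u - x₀) := by
  rw [seg, hm, mul_div_cancel_right₀ _ (sub_pos.2 h).ne']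

lemma seg_mul (t x₀ y₀ x₁ y₁ u : ℝ) :
    seg x₀ (t * y₀) x₁ (t * y₁) u = t * seg x₀ y₀ x₁ y₁ u := by
  unfold seg
  ring

lemma seg_mem_of_convex {s : Set ℝ} (hs : Convex ℝ s) {x₀ x₁ y₀ y₁ u : ℝ} (h₀ : y₀ ∈ s)
    (h₁ : y₁ ∈ s) (hu : u ∈ Icc x₀ x₁) : seg x₀ y₀ x₁ y₁ u ∈ s := by
  rw [seg_eq_lineMap]
  have h : x₀ ≤ x₁ := hu.1.trans hu.2
  exact hs.lineMap_mem h₀ h₁ ⟨div_nonneg (sub_nonneg.2 hu.1) (sub_nonneg.2 h),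
    div_le_one_of_le₀ (sub_le_sub_right hu.2 _) (sub_nonneg.2 h)⟩

variable (D : StripData) (α : ℕ → ℝ)

lemma StripData.eps_succ_lt (k : ℕ) : D.eps (k + 1) < D.eps k :=
  D.eps_strictAnti k.lt_succ_self

lemma StripData.exists_eps_succ_lt {t : ℝ} (ht : 0 < t) : ∃ k, D.eps (k + 1) < t :=
  let ⟨k, hk⟩ := (D.eps_tendsto.eventually (gt_mem_nhds ht)).exists
  ⟨k, (D.eps_succ_lt k).trans hk⟩

lemma continuous_stripVal (k : ℕ) : Continuous (stripVal D α k) := by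
  unfold stripVal
  refine continuous_const.if_le (Continuous.if_le (continuous_seg _ _ _ _)
    (continuous_const.if_le (continuous_seg _ _ _ _) continuous_id continuous_const ?_)
    continuous_id continuous_const ?_) continuous_id continuous_const ?_
  · rintro _ rfl
    rw [seg_left]
  · rintro _ rfl
    rw [if_pos (D.e2_lt_e3 k).le, seg_right (D.e1_lt_e2 k)]
  · rintro _ rfl
    rw [if_pos (D.e1_lt_e2 k).le, seg_left]

lemma stripVal_eps_succ (k : ℕ) : stripVal D α k (D.eps (k + 1)) = lowVal D α k :=
  if_pos (D.eps_lt_e1 k).le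

lemma stripVal_eps (k : ℕ) : stripVal D α k (D.eps k) = topVal D α k := by
  have h34 := D.e3_lt_eps k
  have h23 := (D.e2_lt_e3 k).trans h34
  rw [stripVal, if_neg ((D.e1_lt_e2 k).trans h23).not_ge, if_neg h23.not_ge, if_neg h34.not_ge,
    seg_right h34]

/-- The function equal to `p_α` on `(ε_{k+1}, ∞)` and continued to `(-∞, ε_{k+1}]` by the formula
for the `k`-th strip; being glued from finitely many pieces, it is visibly continuous. -/
def gluedStrips : ℕ → ℝ → ℝ
  | 0 => stripVal D α 0
  | k + 1 => fun t => if t ≤ D.eps (k + 1) then stripVal D α (k + 1) t else gluedStrips k t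

lemma gluedStrips_of_le {k : ℕ} {t : ℝ} (ht : t ≤ D.eps k) :
    gluedStrips D α k t = stripVal D α k t := by
  cases k with
  | zero => rfl
  | succ k => exact if_pos ht

lemma continuous_gluedStrips (k : ℕ) : Continuous (gluedStrips D α k) := by
  induction k with
  | zero => exact continuous_stripVal D α 0
  | succ k ih =>
    refine (continuous_stripVal D α (k + 1)).if_le ih continuous_id continuous_const ?_
    rintro _ rfl
    rw [stripVal_eps, gluedStrips_of_le D α (D.eps_succ_lt k).le, stripVal_eps_succ]
    simp [topVal]

lemma pFun_eq_stripVal {k : ℕ} {t : ℝ} (h₁ : D.eps (k + 1) < t) (h₂ : k = 0 ∨ t ≤ D.eps k) :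
    pFun D α t = stripVal D α k t := by
  classical
  have h : ∃ k, D.eps (k + 1) < t := ⟨k, h₁⟩
  have hk : Nat.find h = k := by
    refine (Nat.find_eq_iff h).2 ⟨h₁, fun m hm hlt => ?_⟩
    rcases h₂ with rfl | h₂
    · exact hm.not_ge m.zero_le
    · exact (hlt.trans_le h₂).not_ge (D.eps_strictAnti.antitone (Nat.succ_le_of_lt hm))
  rw [pFun, dif_pos h]
  congr!

lemma pFun_eq_gluedStrips {k : ℕ} {t : ℝ} (h : D.eps (k + 1) < t) :
    pFun D α t = gluedStrips D α k t := by
  induction k with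
  | zero => exact pFun_eq_stripVal D α h (Or.inl rfl)
  | succ k ih =>
    by_cases ht : t ≤ D.eps (k + 1)
    · rw [gluedStrips_of_le D α ht]
      exact pFun_eq_stripVal D α h (Or.inr ht)
    · exact (ih (not_le.1 ht)).trans (if_neg ht).symm

lemma continuousAt_pFun {t : ℝ} (ht : 0 < t) : ContinuousAt (pFun D α) t := by
  obtain ⟨k, hk⟩ := D.exists_eps_succ_lt ht
  refine (continuous_gluedStrips D α k).continuousAt.congr ?_
  filter_upwards [lt_mem_nhds hk] with s hs
  exact (pFun_eq_gluedStrips D α hs).symm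

variable {α} (hα : ∀ k, α k ∈ Icc (0 : ℝ) 1)

lemma div_four_mem_Icc {x : ℝ} (hx : x ∈ Icc (0 : ℝ) 1) : x / 4 ∈ Icc (0 : ℝ) (1 / 4) :=
  ⟨by linarith [hx.1], by linarith [hx.2]⟩

include hα

lemma lowVal_mem (k : ℕ) : lowVal D α k ∈ Icc (0 : ℝ) (1 / 4) := by
  unfold lowVal
  split_ifs
  exacts [div_four_mem_Icc (D.q_mem 0), div_four_mem_Icc (hα k)]

lemma highVal_mem (k : ℕ) : highVal D α k ∈ Icc (0 : ℝ) (1 / 4) := by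
  unfold highVal
  split_ifs
  exacts [div_four_mem_Icc (hα 0), div_four_mem_Icc (D.q_mem k)]

lemma topVal_mem (k : ℕ) : topVal D α k ∈ Icc (0 : ℝ) (1 / 4) := by
  unfold topVal
  split_ifs
  exacts [⟨by norm_num, le_rfl⟩, lowVal_mem D hα _]

lemma stripVal_mem {k : ℕ} {t : ℝ} (ht : t ≤ D.eps k) :
    stripVal D α k t ∈ Icc (0 : ℝ) (1 / 4) := by
  have hlow := lowVal_mem D hα k
  have hhigh := highVal_mem D hα k
  have htop := topVal_mem D hα k
  have hconv : Convex ℝ (Icc (0 : ℝ) (1 / 4)) := convex_Icc _ _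
  unfold stripVal
  split_ifs with h₁ h₂ h₃
  exacts [hlow, seg_mem_of_convex hconv hlow hhigh ⟨(not_le.1 h₁).le, h₂⟩, hhigh,
    seg_mem_of_convex hconv hhigh htop ⟨(not_le.1 h₃).le, ht⟩]

lemma pFun_mem {t : ℝ} (ht : t ≤ 1) : pFun D α t ∈ Icc (0 : ℝ) (1 / 4) := by
  classical
  unfold pFun
  split_ifs with h
  · apply stripVal_mem D hα
    rcases hk : Nat.find h with _ | k
    · rwa [D.eps_zero]
    · exact not_lt.1 (Nat.find_min h (m := k) (by lia))
  · norm_num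

end PFun

/-! ### The maps `h^α_t` -/

section HMap

/-- The point of `[a, b]` closest to `u`, for `a ≤ b`. Piecewise affine functions are written below
as combinations of clamps, whose increments are monotone and additive in the interval. -/
def clamp (a b u : ℝ) : ℝ := max a (min u b)

lemma clamp_of_le {a b u : ℝ} (hab : a ≤ b) (h : u ≤ a) : clamp a b u = a := by
  rw [clamp, min_eq_left (h.trans hab), max_eq_left h]

lemma clamp_of_mem {a b u : ℝ} (h : u ∈ Icc a b) : clamp a b u = u := by
  rw [clamp, min_eq_left h.2, max_eq_right h.1]

lemma clamp_of_ge {a b u : ℝ} (hab : a ≤ b) (h : b ≤ u) : clamp a b u = b := by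
  rw [clamp, min_eq_right h, max_eq_right hab]

lemma monotone_clamp (a b : ℝ) : Monotone (clamp a b) := fun _ _ h =>
  max_le_max le_rfl (min_le_min h le_rfl)

lemma clamp_sub_clamp_le {a b u v : ℝ} (h : u ≤ v) :
    clamp a b v - clamp a b u ≤ v - u := by
  unfold clamp
  grind

lemma clamp_add_clamp {a b c : ℝ} (hab : a ≤ b) (hbc : b ≤ c) (u : ℝ) :
    clamp a b u + clamp b c u = clamp a c u + b := by
  unfold clamp
  grind

/-- The polyline through `(-1/2, -1/2)`, `(p, 1/4)`, `(1/2, 1/2)`, continued by constants: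
`t * midLine p` is the part of `h^α_t` over `[-1/2, 1/2]`, where it depends on `p = p_α(t)`. -/
def midLine (p u : ℝ) : ℝ :=
  -(1 / 2) + 3 / 4 / (p + 1 / 2) * (clamp (-(1 / 2)) p u + 1 / 2) +
    1 / 4 / (1 / 2 - p) * (clamp p (1 / 2) u - p)

lemma midLine_eq_seg_left {p u : ℝ} (hp : p ≤ 1 / 2) (hu : u ∈ Icc (-(1 / 2)) p) :
    midLine p u = seg (-(1 / 2)) (-(1 / 2)) p (1 / 4) u := by
  rw [midLine, clamp_of_mem hu, clamp_of_le hp hu.2, seg]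
  ring

lemma midLine_eq_seg_right {p u : ℝ} (hp : -(1 / 2) < p) (hu : u ∈ Icc p (1 / 2)) :
    midLine p u = seg p (1 / 4) (1 / 2) (1 / 2) u := by
  rw [midLine, clamp_of_ge hp.le hu.1, clamp_of_mem hu, ← sub_neg_eq_add p,
    div_mul_cancel₀ _ (by linarith), seg]
  ring

variable {p : ℝ} (hp : p ∈ Ioo (-(1 / 2) : ℝ) (1 / 2))

include hp

lemma midLine_of_le {u : ℝ} (hu : u ≤ -(1 / 2)) : midLine p u = -(1 / 2) := by
  rw [midLine, clamp_of_le hp.1.le hu, clamp_of_le hp.2.le (hu.trans hp.1.le)]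
  ring

lemma midLine_of_ge {u : ℝ} (hu : 1 / 2 ≤ u) : midLine p u = 1 / 2 := by
  rw [midLine, clamp_of_ge hp.1.le (hp.2.le.trans hu), clamp_of_ge hp.2.le hu,
    div_mul_cancel₀ _ (by linarith [hp.1]), div_mul_cancel₀ _ (by linarith [hp.2])]
  norm_num

lemma monotone_midLine : Monotone (midLine p) := fun u v huv => by
  have h₁ : 0 < p + 1 / 2 := by linarith [hp.1]
  have h₂ : 0 < 1 / 2 - p := by linarith [hp.2]
  unfold midLine
  gcongr
  exacts [monotone_clamp _ _ huv, monotone_clamp _ _ huv]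

lemma abs_midLine_le (u : ℝ) : |midLine p u| ≤ 1 / 2 := by
  rw [abs_le]
  constructor
  · rw [← midLine_of_le hp (min_le_left (-(1 / 2)) u)]
    exact monotone_midLine hp (min_le_right _ _)
  · rw [← midLine_of_ge hp (le_max_left (1 / 2) u)]
    exact monotone_midLine hp (le_max_right _ _)

lemma polyline_eq {t : ℝ} (ht0 : 0 ≤ t) (ht1 : t < 1) (u : ℝ) :
    polyline p t u = t * midLine p u + (u - clamp (-(1 / 2)) (1 / 2) u) +
      (u - clamp (-((1 + t) / 2)) ((1 + t) / 2) u) := by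
  have hle : -((1 + t) / 2) ≤ (1 + t) / 2 := by linarith
  have hhalf : -(1 / 2 : ℝ) ≤ 1 / 2 := by norm_num
  unfold polyline
  split_ifs with h₁ h₂ h₃ h₄ h₅
  · rw [midLine_of_le hp (by linarith), clamp_of_le hhalf (by linarith),
      clamp_of_le hle (by linarith), seg_eq_of_slope (m := 2) (by linarith) (by ring)]
    ring
  · rw [midLine_of_le hp h₂, clamp_of_le hhalf h₂, clamp_of_mem ⟨by linarith, by linarith⟩,
      seg_eq_of_slope (m := 1) (by linarith) (by ring)]
    ring
  · have hu : u ∈ Icc (-(1 / 2)) p := ⟨(not_le.1 h₂).le, h₃⟩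
    rw [midLine_eq_seg_left hp.2.le hu, clamp_of_mem ⟨hu.1, hu.2.trans hp.2.le⟩,
      clamp_of_mem ⟨by linarith, by linarith [hp.2]⟩, ← seg_mul]
    ring_nf
  · have hu : u ∈ Icc p (1 / 2) := ⟨(not_le.1 h₃).le, h₄⟩
    rw [midLine_eq_seg_right hp.1 hu, clamp_of_mem ⟨hp.1.le.trans hu.1, hu.2⟩,
      clamp_of_mem ⟨by linarith, by linarith⟩, ← seg_mul]
    ring_nf
  · rw [midLine_of_ge hp (by linarith), clamp_of_ge hhalf (by linarith),
      clamp_of_mem ⟨by linarith, h₅⟩, seg_eq_of_slope (m := 1) (by linarith) (by ring)]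
    ring
  · rw [midLine_of_ge hp (by linarith), clamp_of_ge hhalf (by linarith),
      clamp_of_ge hle (by linarith), seg_eq_of_slope (m := 2) (by linarith) (by ring)]
    ring

omit hp

lemma midLine_sub_midLine_ge (hp : p ∈ Icc (0 : ℝ) (1 / 4)) {u v : ℝ} (huv : u ≤ v) :
    (clamp (-(1 / 2)) (1 / 2) v - clamp (-(1 / 2)) (1 / 2) u) / 2 ≤ midLine p v - midLine p u := by
  obtain ⟨hp0, hp1⟩ := hp
  have slope_left : 1 / 2 ≤ 3 / 4 / (p + 1 / 2) := by
    rw [le_div_iff₀ (by linarith)]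
    linarith
  have slope_right : 1 / 2 ≤ 1 / 4 / (1 / 2 - p) := by
    rw [le_div_iff₀ (by linarith)]
    linarith
  have hleft := mul_le_mul_of_nonneg_right slope_left
    (sub_nonneg.2 (monotone_clamp (-(1 / 2)) p huv))
  have hright := mul_le_mul_of_nonneg_right slope_right
    (sub_nonneg.2 (monotone_clamp p (1 / 2) huv))
  have split := clamp_add_clamp (a := -(1 / 2)) (b := p) (c := 1 / 2) (by linarith) (by linarith)
  unfold midLine
  linarith [split u, split v]

variable (D : StripData) {α : ℕ → ℝ} (hα : ∀ k, α k ∈ Icc (0 : ℝ) 1)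

include hα

lemma pFun_mem_Ioo {t : ℝ} (ht : t ≤ 1) : pFun D α t ∈ Ioo (-(1 / 2) : ℝ) (1 / 2) := by
  have h := pFun_mem D hα ht
  constructor <;> linarith [h.1, h.2]

lemma hMap_eq {t : ℝ} (ht0 : 0 ≤ t) (ht1 : t < 1) (u : ℝ) :
    hMap D α t u = t * midLine (pFun D α t) u + (u - clamp (-(1 / 2)) (1 / 2) u) +
      (u - clamp (-((1 + t) / 2)) ((1 + t) / 2) u) := by
  rw [hMap, abs_of_nonneg ht0, polyline_eq (pFun_mem_Ioo D hα ht1.le) ht0 ht1]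

lemma hMap_of_ge {t u : ℝ} (ht0 : 0 ≤ t) (ht1 : t < 1) (hu : (1 + t) / 2 ≤ u) :
    hMap D α t u = 2 * u - 1 := by
  rw [hMap_eq D hα ht0 ht1, midLine_of_ge (pFun_mem_Ioo D hα ht1.le) (by linarith),
    clamp_of_ge (by norm_num) (by linarith), clamp_of_ge (by linarith) hu]
  ring

lemma hMap_of_le {t u : ℝ} (ht0 : 0 ≤ t) (ht1 : t < 1) (hu : u ≤ -((1 + t) / 2)) :
    hMap D α t u = 2 * u + 1 := by
  rw [hMap_eq D hα ht0 ht1, midLine_of_le (pFun_mem_Ioo D hα ht1.le) (by linarith),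
    clamp_of_le (by norm_num) (by linarith), clamp_of_le (by linarith) hu]
  ring

lemma hMap_zero (u : ℝ) : hMap D α 0 u = 2 * (u - clamp (-(1 / 2)) (1 / 2) u) := by
  rw [hMap_eq D hα le_rfl one_pos]
  ring_nf

lemma hMap_sub_hMap_ge {t u v : ℝ} (ht0 : 0 ≤ t) (ht1 : t < 1) (huv : u ≤ v) :
    t / 2 * (v - u) ≤ hMap D α t v - hMap D α t u := by
  rw [hMap_eq D hα ht0 ht1, hMap_eq D hα ht0 ht1]
  have hmid := mul_le_mul_of_nonneg_left
    (midLine_sub_midLine_ge (pFun_mem D hα ht1.le) huv) ht0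
  have hinner := mul_le_mul_of_nonneg_right (show t / 2 ≤ 1 by linarith)
    (sub_nonneg.2 (clamp_sub_clamp_le (a := -(1 / 2)) (b := 1 / 2) huv))
  have houter := clamp_sub_clamp_le (a := -((1 + t) / 2)) (b := (1 + t) / 2) huv
  linarith

lemma strictMono_hMap {t : ℝ} (ht0 : 0 < t) (ht1 : t < 1) : StrictMono (hMap D α t) :=
  fun _ _ huv => sub_pos.1 <|
    (mul_pos (half_pos ht0) (sub_pos.2 huv)).trans_le (hMap_sub_hMap_ge D hα ht0.le ht1 huv.le)

lemma monotone_hMap {t : ℝ} (ht0 : 0 ≤ t) (ht1 : t < 1) : Monotone (hMap D α t) :=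
  fun _ _ huv => sub_nonneg.1 <|
    (mul_nonneg (div_nonneg ht0 zero_le_two) (sub_nonneg.2 huv)).trans
      (hMap_sub_hMap_ge D hα ht0 ht1 huv)

lemma continuousWithinAt_mul_midLine_pFun {t : ℝ} (ht0 : 0 ≤ t) (ht1 : t < 1) (u : ℝ) :
    ContinuousWithinAt (fun x : ℝ × ℝ => x.1 * midLine (pFun D α x.1) x.2) (Ico 0 1 ×ˢ univ)
      (t, u) := by
  rcases ht0.eq_or_lt with rfl | hpos
  · rw [ContinuousWithinAt, zero_mul]
    refine squeeze_zero_norm' (a := fun x : ℝ × ℝ => x.1) ?_ continuous_fst.continuousWithinAt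
    filter_upwards [self_mem_nhdsWithin] with x hx
    rw [norm_mul, Real.norm_of_nonneg hx.1.1]
    refine mul_le_of_le_one_right hx.1.1 ?_
    exact (abs_midLine_le (pFun_mem_Ioo D hα hx.1.2.le) x.2).trans (by norm_num)
  · have hp := pFun_mem_Ioo D hα ht1.le
    have hpFun : ContinuousAt (fun x : ℝ × ℝ => pFun D α x.1) (t, u) :=
      ContinuousAt.comp (g := pFun D α) (continuousAt_pFun D α hpos) continuousAt_fst
    have h₁ : pFun D α t + 1 / 2 ≠ 0 := by linarith [hp.1]
    have h₂ : 1 / 2 - pFun D α t ≠ 0 := by linarith [hp.2]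
    apply ContinuousAt.continuousWithinAt
    unfold midLine clamp
    fun_prop (disch := assumption)

lemma continuousOn_hMap :
    ContinuousOn (fun x : ℝ × ℝ => hMap D α x.1 x.2) (Ico 0 1 ×ˢ univ) := by
  rintro ⟨t, u⟩ ⟨⟨ht0, ht1⟩, -⟩
  have hclamps : Continuous fun x : ℝ × ℝ => (x.2 - clamp (-(1 / 2)) (1 / 2) x.2) +
      (x.2 - clamp (-((1 + x.1) / 2)) ((1 + x.1) / 2) x.2) := by
    unfold clamp
    fun_prop
  refine ((continuousWithinAt_mul_midLine_pFun D hα ht0 ht1 u).add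
    hclamps.continuousWithinAt).congr (fun x hx => ?_) ?_
  · exact (hMap_eq D hα hx.1.1 hx.1.2 x.2).trans (add_assoc _ _ _)
  · exact (hMap_eq D hα ht0 ht1 u).trans (add_assoc _ _ _)

end HMap

/-! ### The maps `h^α_t` as parametrizations of the circle -/

section Circle

lemma coe_rep (θ : UnitAddCircle) : ((rep θ : ℝ) : UnitAddCircle) = θ :=
  AddCircle.coe_equivIco

lemma norm_coe_le_abs (x : ℝ) : ‖(x : UnitAddCircle)‖ ≤ |x| := by
  rw [UnitAddCircle.norm_eq]
  simpa using round_le x 0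

lemma norm_coe_of_abs_le {x : ℝ} (hx : |x| ≤ 1 / 2) : ‖(x : UnitAddCircle)‖ = |x| :=
  (AddCircle.norm_coe_eq_abs_iff 1 one_ne_zero).2 (by rwa [abs_one])

lemma abs_rep_le_half (θ : UnitAddCircle) : |rep θ| ≤ 1 / 2 := by
  obtain ⟨h₁, h₂⟩ := (AddCircle.equivIco (1 : ℝ) (-1 / 2) θ).2
  exact abs_le.2 ⟨by rw [rep]; linarith, by rw [rep]; linarith⟩

lemma abs_rep (θ : UnitAddCircle) : |rep θ| = ‖θ‖ := by
  rw [← norm_coe_of_abs_le (abs_rep_le_half θ), coe_rep]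

lemma norm_le_half (θ : UnitAddCircle) : ‖θ‖ ≤ 1 / 2 :=
  abs_rep θ ▸ abs_rep_le_half θ

lemma coe_half_eq_coe_neg_half :
    ((1 / 2 : ℝ) : UnitAddCircle) = ((-(1 / 2) : ℝ) : UnitAddCircle) := by
  rw [← sub_eq_zero, ← AddCircle.coe_sub]
  norm_num

lemma eq_or_abs_eq_half_of_coe_eq {x y : ℝ} (hx : |x| ≤ 1 / 2) (hy : |y| ≤ 1 / 2)
    (h : (x : UnitAddCircle) = y) : x = y ∨ |x| = 1 / 2 ∧ |y| = 1 / 2 := by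
  have h₀ : ((x - y : ℝ) : UnitAddCircle) = 0 := by
    rw [AddCircle.coe_sub, h, sub_self]
  obtain ⟨n, hn⟩ := (AddCircle.coe_eq_zero_iff 1).1 h₀
  rw [zsmul_eq_mul, mul_one] at hn
  rcases eq_or_ne n 0 with rfl | hn0
  · exact Or.inl (sub_eq_zero.1 (by rw [← hn, Int.cast_zero]))
  · have h1 : (1 : ℝ) ≤ |x - y| := by
      rw [← hn]
      exact_mod_cast Int.one_le_abs hn0
    have h2 := abs_sub x y
    exact Or.inr ⟨by linarith, by linarith⟩

variable (D : StripData) {α : ℕ → ℝ} {r : ℝ}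

variable (α) in
/-- The class of `h^α_r(u)` in `ℝ/ℤ`. For `0 ≤ r ≤ 1/4` the map `h^α_r` carries `[-3/4, 3/4]` onto
`[-1/2, 1/2]`, so that `hCircle D α r` winds `[-3/4, 3/4]` once around the circle: `u` serves as a
coordinate on the circle. -/
def hCircle (r u : ℝ) : UnitAddCircle := (hMap D α r u : ℝ)

section Range

variable (hα : ∀ k, α k ∈ Icc (0 : ℝ) 1) (hr : r ∈ Icc (0 : ℝ) (1 / 4))

include hα hr

lemma hMap_three_quarters : hMap D α r (3 / 4) = 1 / 2 := by
  rw [hMap_of_ge D hα hr.1 (by linarith [hr.2]) (by linarith [hr.2])]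
  norm_num

lemma hMap_neg_three_quarters : hMap D α r (-(3 / 4)) = -(1 / 2) := by
  rw [hMap_of_le D hα hr.1 (by linarith [hr.2]) (by linarith [hr.2])]
  norm_num

lemma abs_hMap_le {u : ℝ} (hu : |u| ≤ 3 / 4) : |hMap D α r u| ≤ 1 / 2 := by
  have hmono := monotone_hMap D hα hr.1 (by linarith [hr.2])
  rw [abs_le] at hu ⊢
  rw [← hMap_neg_three_quarters D hα hr, ← hMap_three_quarters D hα hr]
  exact ⟨hmono hu.1, hmono hu.2⟩

lemma surjOn_hMap : SurjOn (hMap D α r) (Icc (-(3 / 4)) (3 / 4)) (Icc (-(1 / 2)) (1 / 2)) := by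
  have hcont : ContinuousOn (hMap D α r) (Icc (-(3 / 4)) (3 / 4)) :=
    (continuousOn_hMap D hα).comp (f := fun u => (r, u)) (by fun_prop)
      fun u _ => ⟨⟨hr.1, by linarith [hr.2]⟩, mem_univ u⟩
  rw [← hMap_neg_three_quarters D hα hr, ← hMap_three_quarters D hα hr]
  exact intermediate_value_Icc (by norm_num) hcont

lemma exists_hCircle_eq (θ : UnitAddCircle) : ∃ u, |u| ≤ 3 / 4 ∧ hCircle D α r u = θ := by
  obtain ⟨u, hu, hθ⟩ := surjOn_hMap D hα hr (abs_le.1 (abs_rep_le_half θ))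
  exact ⟨u, abs_le.2 hu, by rw [hCircle, hθ, coe_rep]⟩

lemma hMap_lt_half {u : ℝ} (hu : u < 3 / 4) : hMap D α r u < 1 / 2 := by
  have hmono := monotone_hMap D hα hr.1 (by linarith [hr.2])
  refine (hmono (le_max_left u ((1 + r) / 2))).trans_lt ?_
  rw [hMap_of_ge D hα hr.1 (by linarith [hr.2]) (le_max_right _ _)]
  linarith [max_lt hu (show (1 + r) / 2 < 3 / 4 by linarith [hr.2])]

lemma neg_half_lt_hMap {u : ℝ} (hu : -(3 / 4) < u) : -(1 / 2) < hMap D α r u := by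
  have hmono := monotone_hMap D hα hr.1 (by linarith [hr.2])
  refine lt_of_lt_of_le ?_ (hmono (min_le_left u (-((1 + r) / 2))))
  rw [hMap_of_le D hα hr.1 (by linarith [hr.2]) (min_le_right _ _)]
  linarith [lt_min hu (show -(3 / 4) < -((1 + r) / 2) by linarith [hr.2])]

lemma abs_eq_of_abs_hMap_eq {u : ℝ} (hu : |u| ≤ 3 / 4) (h : |hMap D α r u| = 1 / 2) :
    |u| = 3 / 4 := by
  contrapose! h
  obtain ⟨h₁, h₂⟩ := abs_lt.1 (hu.lt_of_ne h)
  exact (abs_lt.2 ⟨neg_half_lt_hMap D hα hr h₁, hMap_lt_half D hα hr h₂⟩).ne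

lemma hMap_eq_or_abs_eq_of_hCircle_eq {u v : ℝ} (hu : |u| ≤ 3 / 4) (hv : |v| ≤ 3 / 4)
    (h : hCircle D α r u = hCircle D α r v) :
    hMap D α r u = hMap D α r v ∨ |u| = 3 / 4 ∧ |v| = 3 / 4 :=
  (eq_or_abs_eq_half_of_coe_eq (abs_hMap_le D hα hr hu) (abs_hMap_le D hα hr hv) h).imp_right
    fun ⟨h₁, h₂⟩ => ⟨abs_eq_of_abs_hMap_eq D hα hr hu h₁, abs_eq_of_abs_hMap_eq D hα hr hv h₂⟩

lemma hCircle_of_abs_eq {u : ℝ} (hu : |u| = 3 / 4) :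
    hCircle D α r u = ((1 / 2 : ℝ) : UnitAddCircle) := by
  rcases eq_or_eq_neg_of_abs_eq hu with rfl | rfl
  · rw [hCircle, hMap_three_quarters D hα hr]
  · rw [hCircle, hMap_neg_three_quarters D hα hr, coe_half_eq_coe_neg_half]

end Range

variable (hα : ∀ k, α k ∈ Icc (0 : ℝ) 1)

include hα

lemma hMap_eq_of_le_abs {δ u : ℝ} (hr : r ∈ Icc 0 δ) (hδ : δ < 1) (hu : (1 + δ) / 2 ≤ |u|) :
    hMap D α r u = hMap D α δ u := by
  have hδ0 := hr.1.trans hr.2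
  have hr1 := hr.2.trans_lt hδ
  rcases le_abs.1 hu with h | h
  · rw [hMap_of_ge D hα hδ0 hδ h, hMap_of_ge D hα hr.1 hr1 (by linarith [hr.2])]
  · rw [hMap_of_le D hα hδ0 hδ (by linarith), hMap_of_le D hα hr.1 hr1 (by linarith [hr.2])]

lemma abs_hMap_le_of_abs_le {δ u : ℝ} (hr : r ∈ Icc 0 δ) (hδ : δ < 1) (hu : |u| ≤ (1 + δ) / 2) :
    |hMap D α r u| ≤ δ := by
  have hr1 := hr.2.trans_lt hδ
  have hmono := monotone_hMap D hα hr.1 hr1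
  obtain ⟨h₁, h₂⟩ := abs_le.1 hu
  have hupper := hmono h₂
  have hlower := hmono h₁
  rw [hMap_of_ge D hα hr.1 hr1 (u := (1 + δ) / 2) (by linarith [hr.2])] at hupper
  rw [hMap_of_le D hα hr.1 hr1 (u := -((1 + δ) / 2)) (by linarith [hr.2])] at hlower
  exact abs_le.2 ⟨by linarith, by linarith⟩

lemma hMap_eq_of_lt_abs {δ u : ℝ} (hr : r ∈ Icc 0 δ) (hδ : δ < 1) (hu : δ < |hMap D α δ u|) :
    hMap D α r u = hMap D α δ u := by
  refine hMap_eq_of_le_abs D hα hr hδ (le_of_not_ge fun h => hu.not_ge ?_)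
  exact abs_hMap_le_of_abs_le D hα ⟨hr.1.trans hr.2, le_rfl⟩ hδ h

lemma abs_hMap_sub_hMap_le {δ : ℝ} (hr : r ∈ Icc 0 δ) (hδ : δ < 1) (u : ℝ) :
    |hMap D α r u - hMap D α δ u| ≤ 2 * δ := by
  have hδ0 := hr.1.trans hr.2
  rcases le_total ((1 + δ) / 2) |u| with h | h
  · rw [hMap_eq_of_le_abs D hα hr hδ h, sub_self, abs_zero]
    exact mul_nonneg zero_le_two hδ0
  · have h₁ := abs_hMap_le_of_abs_le D hα hr hδ h
    have h₂ := abs_hMap_le_of_abs_le D hα ⟨hδ0, le_rfl⟩ hδ h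
    exact (abs_sub _ _).trans (by linarith)

lemma hCircle_congr {r' u v : ℝ} (hr : r ∈ Ioc (0 : ℝ) (1 / 4)) (hr' : r' ∈ Icc (0 : ℝ) (1 / 4))
    (hu : |u| ≤ 3 / 4) (hv : |v| ≤ 3 / 4) (h : hCircle D α r u = hCircle D α r v) :
    hCircle D α r' u = hCircle D α r' v := by
  have hr₀ := Ioc_subset_Icc_self hr
  rcases hMap_eq_or_abs_eq_of_hCircle_eq D hα hr₀ hu hv h with h | ⟨h₁, h₂⟩
  · rw [(strictMono_hMap D hα hr.1 (by linarith [hr.2])).injective h]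
  · rw [hCircle_of_abs_eq D hα hr' h₁, hCircle_of_abs_eq D hα hr' h₂]

lemma hMap_zero_of_abs_le {u : ℝ} (hu : |u| ≤ 1 / 2) : hMap D α 0 u = 0 := by
  rw [hMap_zero D hα, clamp_of_mem (abs_le.1 hu), sub_self, mul_zero]

lemma hMap_zero_eq_zero_of_eq {u v : ℝ} (huv : u ≠ v) (h : hMap D α 0 u = hMap D α 0 v) :
    hMap D α 0 u = 0 := by
  rw [hMap_zero D hα, hMap_zero D hα] at *
  unfold clamp at *
  grind

lemma hCircle_zero_eq_zero_of_eq {u v : ℝ} (hr : r ∈ Icc (0 : ℝ) (1 / 4)) (hu : |u| ≤ 3 / 4)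
    (hv : |v| ≤ 3 / 4) (hne : hCircle D α r u ≠ hCircle D α r v)
    (h : hCircle D α 0 u = hCircle D α 0 v) : hCircle D α 0 u = 0 := by
  have h0 : (0 : ℝ) ∈ Icc (0 : ℝ) (1 / 4) := by norm_num
  rcases hMap_eq_or_abs_eq_of_hCircle_eq D hα h0 hu hv h with h | ⟨h₁, h₂⟩
  · rw [hCircle, hMap_zero_eq_zero_of_eq D hα (fun huv => hne (by rw [huv])) h, AddCircle.coe_zero]
  · exact absurd ((hCircle_of_abs_eq D hα hr h₁).trans (hCircle_of_abs_eq D hα hr h₂).symm) hne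

lemma hCircle_hInv_rep {r' u : ℝ} (hr : r ∈ Ioc (0 : ℝ) (1 / 4)) (hr' : r' ∈ Icc (0 : ℝ) (1 / 4))
    (hu : |u| ≤ 3 / 4) :
    hCircle D α r' (hInv D α r (rep (hCircle D α r u))) = hCircle D α r' u := by
  have hr₀ := Ioc_subset_Icc_self hr
  have hmono := strictMono_hMap D hα hr.1 (by linarith [hr.2])
  obtain ⟨v, hv, hvs⟩ := surjOn_hMap D hα hr₀ (abs_le.1 (abs_rep_le_half (hCircle D α r u)))
  have hexists : ∃ v ∈ Icc (-1 : ℝ) 1, hMap D α r v = rep (hCircle D α r u) :=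
    ⟨v, ⟨by linarith [hv.1], by linarith [hv.2]⟩, hvs⟩
  have hinv : hInv D α r (rep (hCircle D α r u)) = v :=
    hmono.injective ((Function.invFunOn_eq hexists).trans hvs.symm)
  rw [hinv]
  exact hCircle_congr D hα hr hr' (abs_le.2 hv) hu (by rw [hCircle, hvs, coe_rep])

lemma continuousOn_hCircle :
    ContinuousOn (fun x : ℝ × ℝ => hCircle D α x.1 x.2) (Icc 0 (1 / 4) ×ˢ univ) :=
  (AddCircle.continuous_mk' (1 : ℝ)).comp_continuousOn <| (continuousOn_hMap D hα).mono <|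
    prod_mono (fun _ h => ⟨h.1, h.2.trans_lt (by norm_num)⟩) le_rfl

omit hα

lemma continuousOn_dist_fst_snd {Y M : Type*} [TopologicalSpace Y] [PseudoMetricSpace M]
    {K : Set Y} {C : Y → M} (hC : ContinuousOn C K) :
    ContinuousOn (fun y : Y × Y => dist (C y.1) (C y.2)) (K ×ˢ K) :=
  continuous_dist.comp_continuousOn <| (hC.comp continuousOn_fst fun _ h => h.1).prodMk
    (hC.comp continuousOn_snd fun _ h => h.2)

lemma exists_pos_forall_dist_lt_of_isCompact {Y M N : Type*} [TopologicalSpace Y] [T2Space Y]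
    [MetricSpace M] [MetricSpace N] {K : Set Y} (hK : IsCompact K) {A : Y → M} {B : Y → N}
    (hA : ContinuousOn A K) (hB : ContinuousOn B K)
    (hAB : ∀ y ∈ K, ∀ y' ∈ K, A y = A y' → B y = B y') {η : ℝ} (hη : 0 < η) :
    ∃ κ > 0, ∀ y ∈ K, ∀ y' ∈ K, dist (A y) (A y') < κ → dist (B y) (B y') < η := by
  have hKK := hK.prod hK
  have hfar : IsCompact ((K ×ˢ K) ∩ (fun y : Y × Y => dist (B y.1) (B y.2)) ⁻¹' Ici η) :=
    hKK.of_isClosed_subset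
      ((continuousOn_dist_fst_snd hB).preimage_isClosed_of_isClosed hKK.isClosed isClosed_Ici)
      inter_subset_left
  obtain ⟨κ, hκ, hle⟩ := hfar.exists_forall_le'
      ((continuousOn_dist_fst_snd hA).mono inter_subset_left) (a := 0) <| by
    rintro ⟨y, y'⟩ ⟨⟨hy, hy'⟩, hfar⟩
    refine dist_pos.2 fun h => (hη.trans_le hfar).ne' ?_
    exact dist_eq_zero.2 (hAB y hy y' hy' h)
  refine ⟨κ, hκ, fun y hy y' hy' h => lt_of_not_ge fun hge => h.not_ge ?_⟩
  exact hle (y, y') ⟨⟨hy, hy'⟩, hge⟩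

include hα

lemma hCircle_equicontinuous {d η : ℝ} (hd : 0 < d) (hη : 0 < η) :
    ∃ κ > 0, ∀ r₁ ∈ Icc d (1 / 4), ∀ r₁' ∈ Icc d (1 / 4), ∀ r₂ ∈ Icc (0 : ℝ) (1 / 4),
      ∀ r₂' ∈ Icc (0 : ℝ) (1 / 4), ∀ u u' : ℝ, |u| ≤ 3 / 4 → |u'| ≤ 3 / 4 →
      |r₁ - r₁'| < κ → |r₂ - r₂'| < κ → dist (hCircle D α r₁ u) (hCircle D α r₁' u') < κ →
      dist (hCircle D α r₂ u) (hCircle D α r₂' u') < η := by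
  have hK : IsCompact (Icc d (1 / 4) ×ˢ Icc (0 : ℝ) (1 / 4) ×ˢ Icc (-(3 / 4) : ℝ) (3 / 4)) :=
    isCompact_Icc.prod (isCompact_Icc.prod isCompact_Icc)
  have hB := (continuousOn_hCircle D hα).comp
    (f := fun y : ℝ × ℝ × ℝ => (y.2.1, y.2.2)) (s := Icc d (1 / 4) ×ˢ Icc 0 (1 / 4) ×ˢ
      Icc (-(3 / 4)) (3 / 4)) (by fun_prop) fun y hy => ⟨hy.2.1, mem_univ _⟩
  have hA := (continuousOn_hCircle D hα).comp
    (f := fun y : ℝ × ℝ × ℝ => (y.1, y.2.2)) (s := Icc d (1 / 4) ×ˢ Icc 0 (1 / 4) ×ˢ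
      Icc (-(3 / 4)) (3 / 4)) (by fun_prop) fun y hy => ⟨⟨hd.le.trans hy.1.1, hy.1.2⟩, mem_univ _⟩
  obtain ⟨κ, hκ, h⟩ := exists_pos_forall_dist_lt_of_isCompact hK
    (A := fun y => (y.1, y.2.1, hCircle D α y.1 y.2.2)) (by fun_prop) hB (by
      rintro ⟨r₁, r₂, u⟩ ⟨hr₁, hr₂, hu⟩ ⟨r₁', r₂', u'⟩ ⟨-, -, hu'⟩ heq
      simp only [Prod.mk.injEq] at heq
      obtain ⟨rfl, rfl, heq⟩ := heq
      exact hCircle_congr D hα ⟨hd.trans_le hr₁.1, hr₁.2⟩ hr₂ (abs_le.2 hu) (abs_le.2 hu') heq) hη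
  refine ⟨κ, hκ, fun r₁ hr₁ r₁' hr₁' r₂ hr₂ r₂' hr₂' u u' hu hu' h₁ h₂ h₃ => ?_⟩
  exact h (r₁, r₂, u) ⟨hr₁, hr₂, abs_le.1 hu⟩ (r₁', r₂', u') ⟨hr₁', hr₂', abs_le.1 hu'⟩
    (max_lt h₁ (max_lt h₂ h₃))

end Circle

/-! ### The maps `Λ` -/

lemma norm_sub_le_add_of_not_and {E : Type*} [SeminormedAddCommGroup E] {a b x : E} {m d : ℝ}
    (h : ¬(m ≤ ‖a - x‖ ∧ m ≤ ‖b - x‖)) (hab : dist a b ≤ d) :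
    ‖a - x‖ ≤ m + d ∧ ‖b - x‖ ≤ m + d := by
  have hclose : |‖a - x‖ - ‖b - x‖| ≤ d := by
    refine (abs_norm_sub_norm_le _ _).trans ?_
    rwa [sub_sub_sub_cancel_right, ← dist_eq_norm]
  rw [abs_le] at hclose
  grind [dist_nonneg (x := a) (y := b)]

section Lam

lemma mem_square {z w : Torus} {δ : ℝ} :
    w ∈ square z δ ↔ ‖w.1 - z.1‖ ≤ δ ∧ ‖w.2 - z.2‖ ≤ δ := by
  constructor
  · rintro ⟨t, s, ht, hs, rfl⟩
    simp only [add_sub_cancel_left]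
    exact ⟨(norm_coe_le_abs t).trans ht, (norm_coe_le_abs s).trans hs⟩
  · rintro ⟨h₁, h₂⟩
    refine ⟨rep (w.1 - z.1), rep (w.2 - z.2), by rwa [abs_rep], by rwa [abs_rep], ?_⟩
    rw [coe_rep, coe_rep, add_sub_cancel, add_sub_cancel]

lemma min_norm_mem {δ : ℝ} (hδ : δ ∈ Ioc (0 : ℝ) (1 / 4)) (θ : UnitAddCircle) :
    min ‖θ‖ δ ∈ Icc (0 : ℝ) (1 / 4) :=
  ⟨le_min (norm_nonneg _) hδ.1.le, (min_le_right _ _).trans hδ.2⟩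

lemma abs_min_norm_sub_le (a b x : UnitAddCircle) (δ : ℝ) :
    |min ‖a - x‖ δ - min ‖b - x‖ δ| ≤ dist a b := by
  refine (abs_inf_sub_inf_le_abs _ _ _).trans ?_
  rw [dist_eq_norm]
  simpa using abs_norm_sub_norm_le (a - x) (b - x)

variable (D : StripData)

@[simp] lemma lam_fst (α : ℕ → ℝ) (z : Torus) (δ : ℝ) (w : Torus) :
    (lam D α z δ w).1 = w.1 := by
  unfold lam
  split_ifs <;> rfl

lemma lam_add (α : ℕ → ℝ) (z e w : Torus) (δ : ℝ) :
    lam D α (z + e) δ (w + e) = lam D α z δ w + e := by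
  unfold lam
  simp only [mem_square, Prod.fst_add, Prod.snd_add, add_sub_add_right_eq_sub]
  split_ifs
  · exact Prod.ext rfl (add_right_comm _ _ _)
  · rfl

/-- The point on the fibre over `x` with coordinate `u`, relative to the centre `z`, when the
circle is parametrized by `h^α_r`. In these coordinates `Λ` only changes the radius `r`, see
`lam_fibrePt`. -/
def fibrePt (α : ℕ → ℝ) (z : Torus) (x : UnitAddCircle) (r u : ℝ) : Torus :=
  (x, z.2 + hCircle D α r u)

variable {α : ℕ → ℝ} (hα : ∀ k, α k ∈ Icc (0 : ℝ) 1) {δ : ℝ}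

include hα

lemma exists_fibrePt_eq {r : ℝ} (hr : r ∈ Icc (0 : ℝ) (1 / 4)) (z w : Torus) :
    ∃ u, |u| ≤ 3 / 4 ∧ fibrePt D α z w.1 r u = w := by
  obtain ⟨u, hu, h⟩ := exists_hCircle_eq D hα hr (w.2 - z.2)
  exact ⟨u, hu, by rw [fibrePt, h, add_sub_cancel]⟩

lemma fibrePt_equicontinuous {d η : ℝ} (hd : 0 < d) (hη : 0 < η) :
    ∃ κ > 0, ∀ (z : Torus) (x x' : UnitAddCircle),
      ∀ r₁ ∈ Icc d (1 / 4), ∀ r₁' ∈ Icc d (1 / 4),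
      ∀ r₂ ∈ Icc (0 : ℝ) (1 / 4), ∀ r₂' ∈ Icc (0 : ℝ) (1 / 4), ∀ u u' : ℝ,
      |u| ≤ 3 / 4 → |u'| ≤ 3 / 4 → |r₁ - r₁'| ≤ dist x x' → |r₂ - r₂'| ≤ dist x x' →
      dist (fibrePt D α z x r₁ u) (fibrePt D α z x' r₁' u') < κ →
      dist (fibrePt D α z x r₂ u) (fibrePt D α z x' r₂' u') < η := by
  obtain ⟨κ, hκ, h⟩ := hCircle_equicontinuous D hα hd hη
  refine ⟨min κ η, lt_min hκ hη, ?_⟩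
  intro z x x' r₁ hr₁ r₁' hr₁' r₂ hr₂ r₂' hr₂' u u' hu hu' h₁ h₂ hdist
  simp only [fibrePt, Prod.dist_eq, dist_add_left, max_lt_iff, lt_min_iff] at hdist ⊢
  obtain ⟨⟨hxκ, hyκ⟩, hxη, -⟩ := hdist
  exact ⟨hxη, h r₁ hr₁ r₁' hr₁' r₂ hr₂ r₂' hr₂' u u' hu hu' (h₁.trans_lt hxκ) (h₂.trans_lt hxκ)
    hyκ⟩

variable (hδ : δ ∈ Ioc (0 : ℝ) (1 / 4))

include hδ

lemma lam_fibrePt (z : Torus) (x : UnitAddCircle) {u : ℝ} (hu : |u| ≤ 3 / 4) :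
    lam D α z δ (fibrePt D α z x δ u) = fibrePt D α z x (min ‖x - z.1‖ δ) u := by
  have hmin := min_norm_mem hδ (x - z.1)
  unfold lam fibrePt
  simp only [mem_square, add_sub_cancel_left]
  split_ifs with h
  · have hrep : hMap D α (rep (x - z.1)) = hMap D α (min ‖x - z.1‖ δ) := by
      rw [min_eq_left h.1, ← abs_rep]
      unfold hMap
      rw [abs_abs]
    rw [hrep, ← hCircle, hCircle_hInv_rep D hα hδ hmin hu]
  · rcases lt_or_ge δ ‖x - z.1‖ with hx | hx
    · rw [min_eq_right hx.le]
    · have hout : δ < |hMap D α δ u| :=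
        (lt_of_not_ge fun hle => h ⟨hx, hle⟩).trans_le (norm_coe_le_abs _)
      rw [hCircle, hCircle, hMap_eq_of_lt_abs D hα ⟨hmin.1, min_le_right _ _⟩
        (by linarith [hδ.2]) hout]

lemma lam_fibrePt_self (z : Torus) {u : ℝ} (hu : |u| ≤ 3 / 4) :
    lam D α z δ (fibrePt D α z z.1 δ u) = fibrePt D α z z.1 0 u := by
  rw [lam_fibrePt D hα hδ z z.1 hu, sub_self, norm_zero, min_eq_left hδ.1.le]

lemma lam_of_le_norm {z w : Torus} (h : δ ≤ ‖w.1 - z.1‖) : lam D α z δ w = w := by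
  obtain ⟨u, hu, hw⟩ := exists_fibrePt_eq D hα (Ioc_subset_Icc_self hδ) z w
  rw [← hw, lam_fibrePt D hα hδ z _ hu, min_eq_right h]

lemma dist_lam_le (z w : Torus) : dist (lam D α z δ w) w ≤ 2 * δ := by
  obtain ⟨u, hu, hw⟩ := exists_fibrePt_eq D hα (Ioc_subset_Icc_self hδ) z w
  rw [← hw, lam_fibrePt D hα hδ z _ hu, fibrePt, fibrePt, Prod.dist_eq, dist_self, dist_add_left,
    max_eq_right dist_nonneg, dist_eq_norm, hCircle, hCircle, ← AddCircle.coe_sub]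
  exact (norm_coe_le_abs _).trans <| abs_hMap_sub_hMap_le D hα
    ⟨(min_norm_mem hδ _).1, min_le_right _ _⟩ (by linarith [hδ.2]) u

lemma continuous_lam (z : Torus) : Continuous (lam D α z δ) := by
  refine Metric.continuous_iff.2 fun W η hη => ?_
  obtain ⟨κ, hκ, h⟩ := fibrePt_equicontinuous D hα hδ.1 hη
  refine ⟨κ, hκ, fun V hVW => ?_⟩
  obtain ⟨u, hu, hV⟩ := exists_fibrePt_eq D hα (Ioc_subset_Icc_self hδ) z V
  obtain ⟨v, hv, hW⟩ := exists_fibrePt_eq D hα (Ioc_subset_Icc_self hδ) z W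
  rw [← hV, ← hW] at hVW ⊢
  rw [lam_fibrePt D hα hδ z _ hu, lam_fibrePt D hα hδ z _ hv]
  exact h z _ _ δ ⟨le_rfl, hδ.2⟩ δ ⟨le_rfl, hδ.2⟩ _ (min_norm_mem hδ _) _ (min_norm_mem hδ _) u v
    hu hv (by rw [sub_self, abs_zero]; exact dist_nonneg) (abs_min_norm_sub_le _ _ _ _) hVW

lemma exists_lam_eq (z w : Torus) : ∃ v : Torus, v.1 = w.1 ∧ lam D α z δ v = w := by
  obtain ⟨u, hu, hw⟩ := exists_fibrePt_eq D hα (min_norm_mem hδ (w.1 - z.1)) z w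
  exact ⟨fibrePt D α z w.1 δ u, rfl, (lam_fibrePt D hα hδ z _ hu).trans hw⟩

lemma lam_eq_of_fst_eq {z V W : Torus} (hV : V.1 = z.1) (hW : W.1 = z.1) (hVW : V ≠ W)
    (h : lam D α z δ V = lam D α z δ W) : lam D α z δ V = z := by
  obtain ⟨u, hu, hVu⟩ := exists_fibrePt_eq D hα (Ioc_subset_Icc_self hδ) z V
  obtain ⟨v, hv, hWv⟩ := exists_fibrePt_eq D hα (Ioc_subset_Icc_self hδ) z W
  rw [hV] at hVu
  rw [hW] at hWv
  subst hVu hWv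
  rw [lam_fibrePt_self D hα hδ z hu, lam_fibrePt_self D hα hδ z hv] at h
  rw [lam_fibrePt_self D hα hδ z hu, fibrePt]
  have hne : hCircle D α δ u ≠ hCircle D α δ v := fun e => hVW (by rw [fibrePt, fibrePt, e])
  have heq : hCircle D α 0 u = hCircle D α 0 v := add_left_cancel (congrArg Prod.snd h)
  rw [hCircle_zero_eq_zero_of_eq D hα (Ioc_subset_Icc_self hδ) hu hv hne heq, add_zero]

lemma exists_ne_lam_eq (z : Torus) : ∃ V W : Torus, V ≠ W ∧ lam D α z δ V = z ∧
    lam D α z δ W = z := by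
  have h₀ : |(0 : ℝ)| ≤ 1 / 2 := by norm_num
  have h₁ : |(1 / 4 : ℝ)| ≤ 1 / 2 := by norm_num [abs_of_pos]
  have hlam : ∀ {u : ℝ}, |u| ≤ 1 / 2 → lam D α z δ (fibrePt D α z z.1 δ u) = z := fun hu => by
    rw [lam_fibrePt_self D hα hδ z (hu.trans (by norm_num)), fibrePt, hCircle,
      hMap_zero_of_abs_le D hα hu, AddCircle.coe_zero, add_zero]
  refine ⟨_, _, fun h => ?_, hlam h₀, hlam h₁⟩
  rcases hMap_eq_or_abs_eq_of_hCircle_eq D hα (Ioc_subset_Icc_self hδ) (h₀.trans (by norm_num))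
    (h₁.trans (by norm_num)) (add_left_cancel (congrArg Prod.snd h)) with h | ⟨h, -⟩
  · have := (strictMono_hMap D hα hδ.1 (by linarith [hδ.2])).injective h
    norm_num at this
  · norm_num at h

lemma exists_common_coord {δ' : ℝ} (hδ' : δ' ∈ Ioc (0 : ℝ) (1 / 4)) {z V V' : Torus}
    (hV : V.1 ≠ z.1) (hnear : ‖V.1 - z.1‖ ≤ min δ δ') (h : lam D α z δ V' = lam D α z δ' V) :
    ∃ u, |u| ≤ 3 / 4 ∧ V = fibrePt D α z V.1 δ' u ∧ V' = fibrePt D α z V.1 δ u := by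
  obtain ⟨hle, hle'⟩ := le_min_iff.1 hnear
  have hfst : V'.1 = V.1 := by simpa only [lam_fst] using congrArg Prod.fst h
  have hpos : 0 < ‖V.1 - z.1‖ := norm_pos_iff.2 (sub_ne_zero.2 hV)
  obtain ⟨u, hu, hVu⟩ := exists_fibrePt_eq D hα (Ioc_subset_Icc_self hδ') z V
  obtain ⟨u', hu', hVu'⟩ := exists_fibrePt_eq D hα (Ioc_subset_Icc_self hδ) z V'
  refine ⟨u, hu, hVu.symm, ?_⟩
  rw [← hVu, ← hVu', lam_fibrePt D hα hδ z _ hu', lam_fibrePt D hα hδ' z _ hu, hfst,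
    min_eq_left hle, min_eq_left hle'] at h
  rw [← hVu', hfst, fibrePt, fibrePt, hCircle_congr D hα ⟨hpos, hle.trans hδ.2⟩
    (Ioc_subset_Icc_self hδ) hu' hu (add_left_cancel (congrArg Prod.snd h))]

omit hδ

lemma lam_inverse_equicontinuous {d η : ℝ} (hd : 0 < d) (hη : 0 < η) :
    ∃ κ > 0, ∀ z : Torus, ∀ δ ∈ Ioc (0 : ℝ) (1 / 4), ∀ V W : Torus,
      d ≤ ‖V.1 - z.1‖ → d ≤ ‖W.1 - z.1‖ →
      dist (lam D α z δ V) (lam D α z δ W) < κ → dist V W < η := by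
  obtain ⟨κ, hκ, h⟩ := fibrePt_equicontinuous D hα hd hη
  refine ⟨min κ η, lt_min hκ hη, fun z δ hδ V W hV hW hVW => ?_⟩
  rcases le_or_gt δ d with hδd | hδd
  · rw [lam_of_le_norm D hα hδ (hδd.trans hV), lam_of_le_norm D hα hδ (hδd.trans hW)] at hVW
    exact hVW.trans_le (min_le_right _ _)
  · obtain ⟨u, hu, hVu⟩ := exists_fibrePt_eq D hα (Ioc_subset_Icc_self hδ) z V
    obtain ⟨v, hv, hWv⟩ := exists_fibrePt_eq D hα (Ioc_subset_Icc_self hδ) z W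
    rw [← hVu, ← hWv] at hVW ⊢
    rw [lam_fibrePt D hα hδ z _ hu, lam_fibrePt D hα hδ z _ hv] at hVW
    exact h z _ _ _ ⟨le_min hV hδd.le, (min_norm_mem hδ _).2⟩ _
      ⟨le_min hW hδd.le, (min_norm_mem hδ _).2⟩ δ (Ioc_subset_Icc_self hδ) δ
      (Ioc_subset_Icc_self hδ) u v hu hv (abs_min_norm_sub_le _ _ _ _)
      (by rw [sub_self, abs_zero]; exact dist_nonneg) (hVW.trans_le (min_le_left _ _))

lemma lam_symm_comp_equicontinuous_near {δ' η : ℝ} (hδ : δ ∈ Ioc (0 : ℝ) (1 / 4))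
    (hδ' : δ' ∈ Ioc (0 : ℝ) (1 / 4)) (hη : 0 < η) :
    ∃ κ > 0, ∀ z V W V' W' : Torus, V.1 ≠ z.1 → W.1 ≠ z.1 →
      ‖V.1 - z.1‖ ≤ min δ δ' → ‖W.1 - z.1‖ ≤ min δ δ' →
      lam D α z δ V' = lam D α z δ' V → lam D α z δ W' = lam D α z δ' W →
      dist V W < κ → dist V' W' < η := by
  obtain ⟨κ, hκ, h⟩ := fibrePt_equicontinuous D hα hδ'.1 hη
  refine ⟨κ, hκ, fun z V W V' W' hV hW hVnear hWnear hV' hW' hVW => ?_⟩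
  obtain ⟨u, hu, hVu, rfl⟩ := exists_common_coord D hα hδ hδ' hV hVnear hV'
  obtain ⟨v, hv, hWv, rfl⟩ := exists_common_coord D hα hδ hδ' hW hWnear hW'
  rw [hVu, hWv] at hVW
  have hself : ∀ {r : ℝ}, |r - r| ≤ dist V.1 W.1 := by simp
  exact h z _ _ δ' ⟨le_rfl, hδ'.2⟩ δ' ⟨le_rfl, hδ'.2⟩ δ (Ioc_subset_Icc_self hδ) δ
    (Ioc_subset_Icc_self hδ) u v hu hv hself hself hVW

lemma lam_symm_comp_equicontinuous {δ' η : ℝ} (hδ : δ ∈ Ioc (0 : ℝ) (1 / 4))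
    (hδ' : δ' ∈ Ioc (0 : ℝ) (1 / 4)) (z : Torus) (hη : 0 < η) :
    ∃ κ > 0, ∀ V W V' W' : Torus, V.1 ≠ z.1 → W.1 ≠ z.1 →
      lam D α z δ V' = lam D α z δ' V → lam D α z δ W' = lam D α z δ' W →
      dist V W < κ → dist V' W' < η := by
  set m := min δ δ'
  have hm₀ : 0 < m := lt_min hδ.1 hδ'.1
  obtain ⟨κ₁, hκ₁, hnear⟩ := lam_symm_comp_equicontinuous_near D hα hδ hδ' hη
  obtain ⟨κ₂, hκ₂, hfar⟩ := lam_inverse_equicontinuous D hα (half_pos hm₀) hη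
  obtain ⟨κ₃, hκ₃, hcont⟩ := Metric.uniformContinuous_iff.1
    (CompactSpace.uniformContinuous_of_continuous (continuous_lam D hα hδ' z)) κ₂ hκ₂
  refine ⟨min κ₁ (min κ₃ (m / 2)), by positivity, fun V W V' W' hV hW hV' hW' hVW => ?_⟩
  simp only [lt_min_iff] at hVW
  have hfstV : V'.1 = V.1 := by simpa only [lam_fst] using congrArg Prod.fst hV'
  have hfstW : W'.1 = W.1 := by simpa only [lam_fst] using congrArg Prod.fst hW'
  by_cases hsep : m / 2 ≤ ‖V.1 - z.1‖ ∧ m / 2 ≤ ‖W.1 - z.1‖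
  · refine hfar z δ hδ V' W' (by rw [hfstV]; exact hsep.1) (by rw [hfstW]; exact hsep.2) ?_
    rw [hV', hW']
    exact hcont hVW.2.1
  · have hle := norm_sub_le_add_of_not_and hsep ((le_max_left _ _).trans hVW.2.2.le)
    rw [add_halves] at hle
    exact hnear z V W V' W' hV hW hle.1 hle.2 hV' hW' hVW.1

end Lam

/-! ### Pinching families -/

/-- The properties of `Λ z δ` (centre `z`, size `δ ≤ 1/4`) that the construction of `Φ` and `S`
uses. The first two moduli of continuity are uniform in the centre and the size, which is what
allows the sizes to be chosen one after the other. -/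
structure IsPinching (Λ : Torus → ℝ → Torus → Torus) : Prop where
  apply_fst : ∀ z δ w, (Λ z δ w).1 = w.1
  apply_add : ∀ z e w δ, Λ (z + e) δ (w + e) = Λ z δ w + e
  apply_of_le : ∀ {z w : Torus} {δ : ℝ}, δ ∈ Ioc (0 : ℝ) (1 / 4) → δ ≤ ‖w.1 - z.1‖ → Λ z δ w = w
  dist_apply_le : ∀ {δ : ℝ}, δ ∈ Ioc (0 : ℝ) (1 / 4) → ∀ z w, dist (Λ z δ w) w ≤ 2 * δ
  continuous : ∀ {δ : ℝ}, δ ∈ Ioc (0 : ℝ) (1 / 4) → ∀ z, Continuous (Λ z δ)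
  exists_apply_eq : ∀ {δ : ℝ}, δ ∈ Ioc (0 : ℝ) (1 / 4) → ∀ z w, ∃ v : Torus, v.1 = w.1 ∧ Λ z δ v = w
  inverse_equicontinuous : ∀ {d η : ℝ}, 0 < d → 0 < η →
    ∃ κ > 0, ∀ z : Torus, ∀ δ ∈ Ioc (0 : ℝ) (1 / 4), ∀ V W : Torus,
      d ≤ ‖V.1 - z.1‖ → d ≤ ‖W.1 - z.1‖ → dist (Λ z δ V) (Λ z δ W) < κ → dist V W < η
  symm_comp_equicontinuous : ∀ {δ δ' η : ℝ}, δ ∈ Ioc (0 : ℝ) (1 / 4) → δ' ∈ Ioc (0 : ℝ) (1 / 4) →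
    ∀ z, 0 < η → ∃ κ > 0, ∀ V W V' W' : Torus, V.1 ≠ z.1 → W.1 ≠ z.1 →
      Λ z δ V' = Λ z δ' V → Λ z δ W' = Λ z δ' W → dist V W < κ → dist V' W' < η
  apply_eq_of_fst_eq : ∀ {z V W : Torus} {δ : ℝ}, δ ∈ Ioc (0 : ℝ) (1 / 4) →
    V.1 = z.1 → W.1 = z.1 → V ≠ W → Λ z δ V = Λ z δ W → Λ z δ V = z
  exists_ne_apply_eq : ∀ {δ : ℝ}, δ ∈ Ioc (0 : ℝ) (1 / 4) →
    ∀ z, ∃ V W : Torus, V ≠ W ∧ Λ z δ V = z ∧ Λ z δ W = z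

theorem isPinching_lam (D : StripData) {α : ℕ → ℝ} (hα : ∀ k, α k ∈ Icc (0 : ℝ) 1) :
    IsPinching (lam D α) where
  apply_fst := lam_fst D α
  apply_add := lam_add D α
  apply_of_le hδ := lam_of_le_norm D hα hδ
  dist_apply_le := dist_lam_le D hα
  continuous := continuous_lam D hα
  exists_apply_eq := exists_lam_eq D hα
  inverse_equicontinuous := lam_inverse_equicontinuous D hα
  symm_comp_equicontinuous := lam_symm_comp_equicontinuous D hα
  apply_eq_of_fst_eq hδ := lam_eq_of_fst_eq D hα hδ
  exists_ne_apply_eq := exists_ne_lam_eq D hα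

/-! ### The flat distance -/

lemma dist_le_flatDist (v w : Torus) : dist v w ≤ flatDist v w :=
  max_le (Real.le_sqrt_of_sq_le (le_add_of_nonneg_right (sq_nonneg _)))
    (Real.le_sqrt_of_sq_le (le_add_of_nonneg_left (sq_nonneg _)))

lemma flatDist_le_two_mul_dist (v w : Torus) : flatDist v w ≤ 2 * dist v w := by
  have h₁ : dist v.1 w.1 ^ 2 ≤ dist v w ^ 2 := pow_le_pow_left₀ dist_nonneg (le_max_left _ _) 2
  have h₂ : dist v.2 w.2 ^ 2 ≤ dist v w ^ 2 := pow_le_pow_left₀ dist_nonneg (le_max_right _ _) 2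
  exact Real.sqrt_le_iff.2 ⟨by positivity, by linarith [sq_nonneg (dist v w)]⟩

lemma flatDist_nonneg (v w : Torus) : 0 ≤ flatDist v w := Real.sqrt_nonneg _

lemma flatDist_pos {v w : Torus} (h : v ≠ w) : 0 < flatDist v w :=
  (dist_pos.2 h).trans_le (dist_le_flatDist v w)

lemma flatDist_self (v : Torus) : flatDist v v = 0 := by simp [flatDist]

lemma flatDist_le_one (v w : Torus) : flatDist v w ≤ 1 := by
  have h : dist v w ≤ 1 / 2 := by
    rw [Prod.dist_eq, dist_eq_norm, dist_eq_norm]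
    exact max_le (norm_le_half _) (norm_le_half _)
  linarith [flatDist_le_two_mul_dist v w]

lemma continuous_flatDist : Continuous fun p : Torus × Torus => flatDist p.1 p.2 := by
  unfold flatDist
  fun_prop

lemma sqrt_sq_add_sq_le (a b b' : ℝ) : √(a ^ 2 + b ^ 2) ≤ √(a ^ 2 + b' ^ 2) + |b - b'| := by
  have h := norm_le_norm_add_norm_sub' (⟨a, b⟩ : ℂ) ⟨a, b'⟩
  simpa [Complex.norm_eq_sqrt_sq_add_sq, Real.sqrt_sq_eq_abs] using h

lemma flatDist_le_of_fst_eq {v w v' w' : Torus} (hv : v'.1 = v.1) (hw : w'.1 = w.1) :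
    flatDist v w ≤ flatDist v' w' + (dist v' v + dist w' w) := by
  have h : |dist v.2 w.2 - dist v'.2 w'.2| ≤ dist v' v + dist w' w := by
    rw [dist_comm v', dist_comm w']
    exact (dist_dist_dist_le _ _ _ _).trans (add_le_add (le_max_right _ _) (le_max_right _ _))
  unfold flatDist
  rw [hv, hw]
  exact (sqrt_sq_add_sq_le _ _ _).trans (by gcongr)

lemma le_flatDiam_square {x : Torus} {s t : ℝ} (ht : 0 ≤ t) (hts : t ≤ s) (ht2 : t ≤ 1 / 2) :
    t ≤ flatDiam (square x s) := by
  have hnorm : ‖(t : UnitAddCircle)‖ = t := by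
    rw [norm_coe_of_abs_le (by rwa [abs_of_nonneg ht]), abs_of_nonneg ht]
  have hle : t ≤ flatDist (x.1 + (t : UnitAddCircle), x.2) x := calc
    t = dist (x.1 + (t : UnitAddCircle)) x.1 := by rw [dist_eq_norm, add_sub_cancel_left, hnorm]
    _ ≤ dist (x.1 + (t : UnitAddCircle), x.2) x := by rw [Prod.dist_eq]; exact le_max_left _ _
    _ ≤ _ := dist_le_flatDist _ _
  refine hle.trans (le_csSup ⟨1, ?_⟩ ⟨_, ?_, _, ?_, rfl⟩)
  · rintro r ⟨v, -, w, -, rfl⟩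
    exact flatDist_le_one v w
  · simpa [mem_square, hnorm] using ⟨hts, ht.trans hts⟩
  · simpa [mem_square] using ht.trans hts

lemma lt_of_flatDiam_square_lt {x : Torus} {s ε : ℝ} (hs : 0 < s) (hε : ε ≤ 1 / 2)
    (h : flatDiam (square x s) < ε) : s < ε := by
  have hmin : min s (1 / 2) ≤ flatDiam (square x s) :=
    le_flatDiam_square (le_min hs.le (by norm_num)) (min_le_left _ _) (min_le_right _ _)
  exact (min_lt_iff.1 (hmin.trans_lt h)).resolve_right hε.not_gt

/-! ### Compositions -/

/-- The composition `L (n - 1) ∘ ⋯ ∘ L 0`, the identity for `n = 0`. -/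
def compBelow (L : ℕ → Torus → Torus) : ℕ → Torus → Torus
  | 0 => id
  | n + 1 => L n ∘ compBelow L n

lemma compUpTo_eq (L : ℕ → Torus → Torus) (n : ℕ) : compUpTo L n = compBelow L (n + 1) := by
  induction n with
  | zero => rfl
  | succ n ih => rw [compUpTo, ih]; rfl

/-- The complement of the fibres over the first coordinates of the centres `z n`; for the orbit of
the rotation this is the set `X`. -/
def offFibres (z : ℕ → Torus) : Set Torus := {w | ∀ n, w.1 ≠ (z n).1}

lemma mem_offFibres_congr {z : ℕ → Torus} {v w : Torus} (h : v.1 = w.1) :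
    v ∈ offFibres z ↔ w ∈ offFibres z := by
  simp only [offFibres, mem_ofPred_eq, h]

/-- The sizes for which the maps of a pinching family are controlled. -/
def SmallSizes (δ : ℕ → ℝ) : Prop := ∀ n, δ n ∈ Ioc (0 : ℝ) (1 / 4)

/-- The composition of the members of the family `Λ` with the first `n` of the centres `z` and of
the sizes `δ`. -/
def pinchComp (Λ : Torus → ℝ → Torus → Torus) (z : ℕ → Torus) (δ : ℕ → ℝ) (n : ℕ) :
    Torus → Torus :=
  compBelow (fun k => Λ (z k) (δ k)) n

section PinchComp

variable {Λ : Torus → ℝ → Torus → Torus} {z : ℕ → Torus} {δ δ' : ℕ → ℝ}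

lemma pinchComp_succ (n : ℕ) (w : Torus) :
    pinchComp Λ z δ (n + 1) w = Λ (z n) (δ n) (pinchComp Λ z δ n w) := rfl

variable (hΛ : IsPinching Λ)

include hΛ

lemma pinchComp_fst (n : ℕ) (w : Torus) : (pinchComp Λ z δ n w).1 = w.1 := by
  induction n with
  | zero => rfl
  | succ n ih => rw [pinchComp_succ, hΛ.apply_fst, ih]

lemma pinchComp_add (e : Torus) (n : ℕ) (w : Torus) :
    pinchComp Λ (fun k => z k + e) δ n (w + e) = pinchComp Λ z δ n w + e := by
  induction n with
  | zero => rfl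
  | succ n ih => rw [pinchComp_succ, pinchComp_succ, ih, hΛ.apply_add]

lemma fst_eq_of_pinchComp_eq {n : ℕ} {A w : Torus}
    (h : pinchComp Λ z δ' n A = pinchComp Λ z δ n w) : A.1 = w.1 := by
  simpa only [pinchComp_fst hΛ] using congrArg Prod.fst h

lemma pinchComp_inverse_equicontinuous (z : ℕ → Torus) (n : ℕ) {d η : ℝ} (hd : 0 < d)
    (hη : 0 < η) :
    ∃ κ > 0, ∀ δ, SmallSizes δ → ∀ V W : Torus,
      (∀ k < n, d ≤ ‖V.1 - (z k).1‖ ∧ d ≤ ‖W.1 - (z k).1‖) →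
      dist (pinchComp Λ z δ n V) (pinchComp Λ z δ n W) < κ → dist V W < η := by
  induction n generalizing η with
  | zero => exact ⟨η, hη, fun δ _ V W _ h => h⟩
  | succ n ih =>
    obtain ⟨κ₁, hκ₁, h₁⟩ := ih hη
    obtain ⟨κ₂, hκ₂, h₂⟩ := hΛ.inverse_equicontinuous hd hκ₁
    refine ⟨κ₂, hκ₂, fun δ hδ V W hVW h => h₁ δ hδ V W (fun k hk => hVW k (by lia)) ?_⟩
    refine h₂ (z n) (δ n) (hδ n) _ _ ?_ ?_ h
    all_goals rw [pinchComp_fst hΛ]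
    exacts [(hVW n n.lt_succ_self).1, (hVW n n.lt_succ_self).2]

lemma IsPinching.fst_eq_of_apply_eq {s : ℝ} (hs : s ∈ Ioc (0 : ℝ) (1 / 4)) {x V W : Torus}
    (hVW : V ≠ W) (h : Λ x s V = Λ x s W) : V.1 = x.1 ∧ W.1 = x.1 := by
  have hfst : V.1 = W.1 := by simpa only [hΛ.apply_fst] using congrArg Prod.fst h
  suffices V.1 = x.1 from ⟨this, hfst ▸ this⟩
  by_contra hne
  obtain ⟨κ, hκ, hinv⟩ := hΛ.inverse_equicontinuous (norm_pos_iff.2 (sub_ne_zero.2 hne))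
    (dist_pos.2 hVW)
  exact (hinv x s hs V W le_rfl (hfst ▸ le_rfl) (by rwa [h, dist_self])).false

variable (hδ : SmallSizes δ)

include hδ

lemma continuous_pinchComp (n : ℕ) : Continuous (pinchComp Λ z δ n) := by
  induction n with
  | zero => exact continuous_id
  | succ n ih => exact (hΛ.continuous (hδ n) (z n)).comp ih

lemma dist_pinchComp_succ_le (n : ℕ) (w : Torus) :
    dist (pinchComp Λ z δ (n + 1) w) (pinchComp Λ z δ n w) ≤ 2 * δ n :=
  hΛ.dist_apply_le (hδ n) _ _

lemma pinchComp_succ_of_le {n : ℕ} {w : Torus} (h : δ n ≤ ‖w.1 - (z n).1‖) :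
    pinchComp Λ z δ (n + 1) w = pinchComp Λ z δ n w := by
  rw [pinchComp_succ]
  exact hΛ.apply_of_le (hδ n) (by rwa [pinchComp_fst hΛ])

lemma exists_pinchComp_eq (n : ℕ) (w : Torus) : ∃ v, v.1 = w.1 ∧ pinchComp Λ z δ n v = w := by
  induction n generalizing w with
  | zero => exact ⟨w, rfl, rfl⟩
  | succ n ih =>
    obtain ⟨u, hu, rfl⟩ := hΛ.exists_apply_eq (hδ n) (z n) w
    obtain ⟨v, hv, rfl⟩ := ih u
    exact ⟨v, hv.trans hu, rfl⟩

lemma exists_pinchComp_eq_center {N : ℕ} {v w : Torus} (hvw : v ≠ w)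
    (h : pinchComp Λ z δ N v = pinchComp Λ z δ N w) : ∃ n, pinchComp Λ z δ (n + 1) v = z n := by
  induction N with
  | zero => exact absurd h hvw
  | succ N ih =>
    by_cases hN : pinchComp Λ z δ N v = pinchComp Λ z δ N w
    · exact ih hN
    · obtain ⟨hv, hw⟩ := hΛ.fst_eq_of_apply_eq (hδ N) hN h
      exact ⟨N, hΛ.apply_eq_of_fst_eq (hδ N) hv hw hN h⟩

lemma injOn_pinchComp (n : ℕ) : InjOn (pinchComp Λ z δ n) (offFibres z) := by
  intro v hv w _ h
  by_contra hvw
  obtain ⟨k, hk⟩ := exists_pinchComp_eq_center hΛ hδ hvw h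
  exact hv k (by rw [← hk, pinchComp_fst hΛ])

lemma bijOn_pinchComp (n : ℕ) : BijOn (pinchComp Λ z δ n) (offFibres z) (offFibres z) := by
  refine ⟨fun w hw => (mem_offFibres_congr (pinchComp_fst hΛ n w)).2 hw,
    injOn_pinchComp hΛ hδ n, fun w hw => ?_⟩
  obtain ⟨v, hv, h⟩ := exists_pinchComp_eq (z := z) hΛ hδ n w
  exact ⟨v, (mem_offFibres_congr hv).2 hw, h⟩

lemma exists_ne_pinchComp_eq_center (n : ℕ) :
    ∃ v w : Torus, v ≠ w ∧ pinchComp Λ z δ (n + 1) v = z n ∧ pinchComp Λ z δ (n + 1) w = z n := by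
  obtain ⟨V, W, hne, hV, hW⟩ := hΛ.exists_ne_apply_eq (hδ n) (z n)
  obtain ⟨v, -, rfl⟩ := exists_pinchComp_eq (z := z) hΛ hδ n V
  obtain ⟨w, -, rfl⟩ := exists_pinchComp_eq (z := z) hΛ hδ n W
  exact ⟨v, w, fun e => hne (by rw [e]), hV, hW⟩

end PinchComp

/-! ### Thresholds for the sizes -/

lemma exists_gap {E : Type*} [NormedAddCommGroup E] {f : ℕ → E} (hf : Function.Injective f)
    (n N : ℕ) : ∃ g > 0, ∀ j < N, j ≠ n → g ≤ ‖f n - f j‖ := by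
  have h : ∀ᶠ g in 𝓝[>] (0 : ℝ), ∀ j ∈ Iio N, j ≠ n → g ≤ ‖f n - f j‖ := by
    refine (eventually_all_finite (finite_Iio N)).2 fun j _ => ?_
    rcases eq_or_ne j n with rfl | hj
    · simp
    · filter_upwards [nhdsWithin_le_nhds (eventually_le_nhds
        (norm_pos_iff.2 (sub_ne_zero.2 (hf.ne hj.symm))))] with g hg _ using hg
  exact (eventually_mem_nhdsWithin.and h).exists

lemma sub_le_norm_sub {E : Type*} [SeminormedAddCommGroup E] {g a : ℝ} {x y v : E}
    (h : g ≤ ‖x - y‖) (hv : ‖v - x‖ ≤ a) : g - a ≤ ‖v - y‖ := by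
  have := norm_sub_le_norm_sub_add_norm_sub x v y
  rw [norm_sub_rev x v] at this
  linarith

section Thresholds

variable {Λ : Torus → ℝ → Torus → Torus} {z : ℕ → Torus} {δ δ' : ℕ → ℝ} (hΛ : IsPinching Λ)
  (hz : Function.Injective fun n => (z n).1)

include hΛ

section Injective

include hz

-- Two images close to each other would both lie near the fibre over `z n`, hence away from the
-- earlier centres, where the inverse of the composition is controlled.
lemma exists_le_dist_pinchComp (n : ℕ) {s : ℝ} (hs : 0 < s) :
    ∃ d > 0, ∀ δ, SmallSizes δ → δ n ≤ d → ∀ V W : Torus, s ≤ flatDist V W →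
      ¬(δ n ≤ ‖V.1 - (z n).1‖ ∧ δ n ≤ ‖W.1 - (z n).1‖) →
      d ≤ dist (pinchComp Λ z δ n V) (pinchComp Λ z δ n W) := by
  obtain ⟨g, hg, hgap⟩ := exists_gap hz n n
  obtain ⟨κ, hκ, hinv⟩ := pinchComp_inverse_equicontinuous hΛ z n (half_pos hg) (half_pos hs)
  refine ⟨min κ (g / 4), by positivity, fun δ hδ hδn V W hVW hmoved => ?_⟩
  by_contra! hlt
  obtain ⟨hltκ, hltg⟩ := lt_min_iff.1 hlt
  have hfst : dist V.1 W.1 ≤ g / 4 := by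
    rw [← pinchComp_fst (z := z) (δ := δ) hΛ n V, ← pinchComp_fst (z := z) (δ := δ) hΛ n W]
    exact (le_max_left _ _).trans hltg.le
  obtain ⟨hV, hW⟩ := norm_sub_le_add_of_not_and hmoved hfst
  have hδg : δ n ≤ g / 4 := hδn.trans (min_le_right _ _)
  have := hinv δ hδ V W (fun k hk => ?_) hltκ
  · linarith [flatDist_le_two_mul_dist V W]
  · have hk' := hgap k hk hk.ne
    constructor
    · linarith [sub_le_norm_sub hk' hV]
    · linarith [sub_le_norm_sub hk' hW]

lemma exists_separation_threshold (n : ℕ) {s b : ℝ} (hs : 0 < s) (hb : 0 < b) :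
    ∃ ε > 0, ∀ δ, SmallSizes δ → δ n < ε → ∀ V W : Torus, s ≤ flatDist V W →
      (1 - b) * flatDist (pinchComp Λ z δ n V) (pinchComp Λ z δ n W) ≤
        flatDist (pinchComp Λ z δ (n + 1) V) (pinchComp Λ z δ (n + 1) W) := by
  obtain ⟨d, hd, hfar⟩ := exists_le_dist_pinchComp hΛ hz n hs
  refine ⟨min d (b * d / 4), by positivity, fun δ hδ hε V W hVW => ?_⟩
  obtain ⟨hεd, hεb⟩ := lt_min_iff.1 hε
  have hnonneg := flatDist_nonneg (pinchComp Λ z δ n V) (pinchComp Λ z δ n W)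
  by_cases hfixed : δ n ≤ ‖V.1 - (z n).1‖ ∧ δ n ≤ ‖W.1 - (z n).1‖
  · rw [pinchComp_succ_of_le hΛ hδ hfixed.1, pinchComp_succ_of_le hΛ hδ hfixed.2]
    exact mul_le_of_le_one_left hnonneg (by linarith)
  · have hle := (hfar δ hδ hεd.le V W hVW hfixed).trans (dist_le_flatDist _ _)
    have hmove := flatDist_le_of_fst_eq (hΛ.apply_fst (z n) (δ n) (pinchComp Λ z δ n V))
      (hΛ.apply_fst (z n) (δ n) (pinchComp Λ z δ n W))
    have hV := dist_pinchComp_succ_le (z := z) hΛ hδ n V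
    have hW := dist_pinchComp_succ_le (z := z) hΛ hδ n W
    simp only [pinchComp_succ] at hV hW ⊢
    linarith [mul_le_mul_of_nonneg_left hle hb.le]

lemma exists_cauchy_threshold (n : ℕ) {η : ℝ} (hη : 0 < η) :
    ∃ ε > 0, ∀ δ δ', SmallSizes δ → SmallSizes δ' → δ n < ε → δ' n < ε → ∀ w ∈ offFibres z,
      ∀ A B : Torus, pinchComp Λ z δ' n A = pinchComp Λ z δ n w →
      pinchComp Λ z δ' (n + 1) B = pinchComp Λ z δ (n + 1) w → dist A B < η := by
  obtain ⟨g, hg, hgap⟩ := exists_gap hz n n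
  obtain ⟨κ, hκ, hinv⟩ := pinchComp_inverse_equicontinuous hΛ z n (half_pos hg) hη
  refine ⟨min (g / 2) (κ / 4), by positivity, fun δ δ' hδ hδ' hε hε' w hw A B hA hB => ?_⟩
  rw [lt_min_iff] at hε hε'
  have hAfst := fst_eq_of_pinchComp_eq hΛ hA
  have hBfst := fst_eq_of_pinchComp_eq hΛ hB
  by_cases hfixed : δ n ≤ ‖w.1 - (z n).1‖ ∧ δ' n ≤ ‖w.1 - (z n).1‖
  · rw [pinchComp_succ_of_le hΛ hδ hfixed.1,
      pinchComp_succ_of_le hΛ hδ' (by rw [hBfst]; exact hfixed.2), ← hA] at hB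
    rwa [injOn_pinchComp hΛ hδ' n ((mem_offFibres_congr hBfst).2 hw)
      ((mem_offFibres_congr hAfst).2 hw) hB, dist_self]
  · have hnear : ‖w.1 - (z n).1‖ ≤ g / 2 := by
      by_contra! hlt
      exact hfixed ⟨(hε.1.trans hlt).le, (hε'.1.trans hlt).le⟩
    refine hinv δ' hδ' A B (fun k hk => ?_) ?_
    · rw [hAfst, hBfst, and_self]
      linarith [sub_le_norm_sub (hgap k hk hk.ne) hnear]
    · have h := dist_pinchComp_succ_le (z := z) hΛ hδ n w
      have h' := dist_pinchComp_succ_le (z := z) hΛ hδ' n B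
      rw [hB] at h'
      rw [hA]
      linarith [dist_triangle_left (pinchComp Λ z δ n w) (pinchComp Λ z δ' n B)
        (pinchComp Λ z δ (n + 1) w)]

end Injective

lemma pinchComp_symm_comp_equicontinuous (hδ : SmallSizes δ) (hδ' : SmallSizes δ')
    (hgap : ∀ n, ∀ k < n, 4 * δ n ≤ ‖(z n).1 - (z k).1‖)
    (hgap' : ∀ n, ∀ k < n, 4 * δ' n ≤ ‖(z n).1 - (z k).1‖) (n : ℕ) {η : ℝ} (hη : 0 < η) :
    ∃ κ > 0, ∀ V ∈ offFibres z, ∀ W ∈ offFibres z, ∀ V' W' : Torus,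
      pinchComp Λ z δ' n V' = pinchComp Λ z δ n V →
      pinchComp Λ z δ' n W' = pinchComp Λ z δ n W →
      dist V W < κ → dist V' W' < η := by
  induction n with
  | zero =>
    exact ⟨η, hη, fun V _ W _ V' W' hV hW h => by rwa [show V' = V from hV, show W' = W from hW]⟩
  | succ n ih =>
    set m := max (δ n) (δ' n)
    have hm : 0 < m := lt_max_of_lt_left (hδ n).1
    obtain ⟨κ₁, hκ₁, hinv⟩ := pinchComp_inverse_equicontinuous hΛ z n (d := 2 * m)
      (by positivity) hη
    obtain ⟨κ₂, hκ₂, hstep⟩ := hΛ.symm_comp_equicontinuous (hδ' n) (hδ n) (z n) hκ₁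
    obtain ⟨κ₃, hκ₃, hcont⟩ := Metric.uniformContinuous_iff.1
      (CompactSpace.uniformContinuous_of_continuous
        (continuous_pinchComp (z := z) hΛ hδ n)) κ₂ hκ₂
    obtain ⟨κ₄, hκ₄, hfar⟩ := ih
    refine ⟨min m (min κ₃ κ₄), by positivity, fun V hV W hW V' W' hV' hW' hVW => ?_⟩
    simp only [lt_min_iff] at hVW
    have hVfst := fst_eq_of_pinchComp_eq hΛ hV'
    have hWfst := fst_eq_of_pinchComp_eq hΛ hW'
    by_cases hfixed : m ≤ ‖V.1 - (z n).1‖ ∧ m ≤ ‖W.1 - (z n).1‖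
    · have hdrop : ∀ A A' : Torus, m ≤ ‖A.1 - (z n).1‖ → A'.1 = A.1 →
          pinchComp Λ z δ' (n + 1) A' = pinchComp Λ z δ (n + 1) A →
          pinchComp Λ z δ' n A' = pinchComp Λ z δ n A := fun A A' hA hfst h => by
        rwa [pinchComp_succ_of_le hΛ hδ ((le_max_left _ _).trans hA),
          pinchComp_succ_of_le hΛ hδ' (by rw [hfst]; exact (le_max_right _ _).trans hA)] at h
      exact hfar V hV W hW V' W' (hdrop V V' hfixed.1 hVfst hV') (hdrop W W' hfixed.2 hWfst hW')
        hVW.2.2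
    · obtain ⟨hVnear, hWnear⟩ := norm_sub_le_add_of_not_and hfixed
        ((le_max_left _ _).trans hVW.1.le)
      refine hinv δ' hδ' V' W' (fun k hk => ?_) <| hstep _ _ _ _ ?_ ?_ hV' hW' (hcont hVW.2.1)
      · have hgm : 4 * m ≤ ‖(z n).1 - (z k).1‖ := by
          rw [mul_max_of_nonneg _ _ (by norm_num)]
          exact max_le (hgap n k hk) (hgap' n k hk)
        rw [hVfst, hWfst]
        constructor
        · linarith [sub_le_norm_sub hgm hVnear]
        · linarith [sub_le_norm_sub hgm hWnear]
      · exact fun h => hV n ((pinchComp_fst hΛ n V).symm.trans h)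
      · exact fun h => hW n ((pinchComp_fst hΛ n W).symm.trans h)

end Thresholds

/-! ### The orbit of the rotation -/

lemma rot_symm (c : Torus) : (rot c).symm = rot (-c) :=
  Homeomorph.ext fun _ => rfl

lemma rot_zpow_apply (c w : Torus) (k : ℤ) : (rot c ^ k) w = w + k • c := by
  induction k using Int.induction_on with
  | zero => simp
  | succ k ih =>
    rw [add_comm, zpow_add, zpow_one, Homeomorph.mul_apply, ih, add_zsmul, one_zsmul, add_comm c,
      ← add_assoc]
    rfl
  | pred k ih =>
    rw [sub_eq_neg_add, zpow_add, zpow_neg_one, Homeomorph.mul_apply, ih, add_zsmul, neg_one_zsmul,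
      add_comm (-c), ← add_assoc]
    rfl

lemma not_isOfFinAddOrder_of_isMinimalHomeo {c : Torus} (hT : IsMinimalHomeo (rot c)) :
    ¬IsOfFinAddOrder c.1 := by
  intro hc
  obtain ⟨n, hn, hnc⟩ := isOfFinAddOrder_iff_nsmul_eq_zero.1 hc
  have hclosed : IsClosed {w : Torus | n • w.1 = 0} :=
    isClosed_eq (by fun_prop) continuous_const
  have horbit : range (fun k : ℤ => (rot c ^ k) (0 : Torus)) ⊆ {w : Torus | n • w.1 = 0} := by
    rintro _ ⟨k, rfl⟩
    change n • ((rot c ^ k) (0 : Torus)).1 = 0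
    rw [rot_zpow_apply, zero_add, Prod.smul_fst, smul_comm, hnc, smul_zero]
  have htorsion : n • ((1 / (n + 1 : ℕ) : ℝ) : UnitAddCircle) = 0 :=
    hclosed.closure_subset_iff.2 horbit (hT 0 (((1 / (n + 1 : ℕ) : ℝ) : UnitAddCircle), 0))
  have hdvd := addOrderOf_dvd_of_nsmul_eq_zero htorsion
  rw [AddCircle.addOrderOf_period_div n.succ_pos] at hdvd
  exact absurd (Nat.le_of_dvd hn hdvd) (by lia)

lemma orbitIndex_injective : Function.Injective orbitIndex := by
  intro m n h
  unfold orbitIndex at h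
  grind

lemma orbitPt_fst_injective {c : Torus} (hc : ¬IsOfFinAddOrder c.1) (z₀ : Torus) :
    Function.Injective fun n => (orbitPt c z₀ n).1 := by
  intro m n h
  simp only [orbitPt, rot_zpow_apply, Prod.fst_add, Prod.smul_fst, add_right_inj] at h
  exact orbitIndex_injective (injective_zsmul_iff_not_isOfFinAddOrder.2 hc h)

lemma tau_leftInverse_sigma : Function.LeftInverse tau sigma := fun n =>
  orbitIndex_injective (by rw [orbitIndex_tau, orbitIndex_sigma, neg_add_cancel_left])

lemma sigma_leftInverse_tau : Function.LeftInverse sigma tau := fun n =>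
  orbitIndex_injective (by rw [orbitIndex_sigma, orbitIndex_tau, add_neg_cancel_left])

/-- The rotation by `e` permutes the centres `z` by `ρ`, and `ρ` does not change the order of the
indices too much. For the orbit of `T`, this holds for `T`, `σ` and for `T⁻¹`, `τ`. -/
structure IsShift (z : ℕ → Torus) (e : Torus) (ρ : ℕ → ℕ) : Prop where
  rot_apply : ∀ k, rot e (z k) = z (ρ k)
  surjective : Function.Surjective ρ
  le_add_three : ∀ ⦃k n⦄, k < n → ρ k ≤ ρ n + 3

lemma isShift_sigma (c z₀ : Torus) : IsShift (orbitPt c z₀) c sigma where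
  rot_apply := rot_orbitPt c z₀
  surjective := sigma_leftInverse_tau.surjective
  le_add_three k n h := by
    unfold sigma
    grind

lemma isShift_tau (c z₀ : Torus) : IsShift (orbitPt c z₀) (-c) tau where
  rot_apply k := by rw [← rot_symm, rot_symm_orbitPt]
  surjective := tau_leftInverse_sigma.surjective
  le_add_three k n h := by
    unfold tau
    grind

section IsShift

variable {z : ℕ → Torus} {e : Torus} {ρ : ℕ → ℕ} (h : IsShift z e ρ)

include h

lemma IsShift.injective (hz : Function.Injective z) : Function.Injective ρ := by
  intro j k hjk
  apply hz
  rw [← (rot e).injective.eq_iff, h.rot_apply, h.rot_apply, hjk]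

lemma IsShift.mapsTo_offFibres : MapsTo (rot e) (offFibres z) (offFibres z) := by
  intro w hw n hn
  obtain ⟨k, rfl⟩ := h.surjective n
  rw [← h.rot_apply] at hn
  exact hw k (add_right_cancel hn)

lemma IsShift.offFibres_comp : offFibres (fun k => z (ρ k)) = offFibres z := by
  ext w
  exact (h.surjective.forall (p := fun n => w.1 ≠ (z n).1)).symm

end IsShift

lemma dense_compl_of_countable {s : Set UnitAddCircle} (hs : s.Countable) : Dense sᶜ := by
  have hpre : ((↑) ⁻¹' s : Set ℝ).Countable := by
    have := hs.to_subtype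
    refine (countable_range fun p : s × ℤ => rep p.1 + p.2).mono fun x hx => ?_
    have hx0 : ((x - rep x : ℝ) : UnitAddCircle) = 0 := by
      rw [AddCircle.coe_sub, coe_rep, sub_self]
    obtain ⟨m, hm⟩ := (AddCircle.coe_eq_zero_iff 1).1 hx0
    rw [zsmul_eq_mul, mul_one] at hm
    exact ⟨(⟨x, hx⟩, m), by
      dsimp only
      rw [hm, add_sub_cancel]⟩
  exact QuotientAddGroup.dense_preimage_mk.1 (hpre.dense_compl ℝ)

lemma dense_offFibres (z : ℕ → Torus) : Dense (offFibres z) := by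
  have h : offFibres z = (range fun n => (z n).1)ᶜ ×ˢ univ := by
    ext w
    simp [offFibres, eq_comm]
  rw [h]
  exact (dense_compl_of_countable (countable_range _)).prod dense_univ

/-! ### Reordering the compositions -/

section Reorder

variable {L : ℕ → Torus → Torus}

section Shift

variable {ρ : ℕ → ℕ} {M : ℕ} (hL : ∀ j k, j ≤ k + 3 → k ≤ j + 3 → Function.Commute (L j) (L k))
  (hbase : ∀ w, compBelow (fun k => L (ρ k)) (M + 1) w = L (M + 1) (compBelow L M w))
  (hup : ∀ j, ρ (M + 2 * j + 1) = M + 2 * j + 3) (hdown : ∀ j, ρ (M + 2 * j + 2) = M + 2 * j)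

include hL hbase hup hdown

lemma compBelow_reorder (j : ℕ) (w : Torus) :
    compBelow (fun k => L (ρ k)) (M + 2 * j + 1) w =
      L (M + 2 * j + 1) (compBelow L (M + 2 * j) w) := by
  induction j with
  | zero => exact hbase w
  | succ j ih =>
    set y := compBelow L (M + 2 * j) w
    calc L (ρ (M + 2 * j + 2)) (L (ρ (M + 2 * j + 1))
          (compBelow (fun k => L (ρ k)) (M + 2 * j + 1) w))
      _ = L (M + 2 * j) (L (M + 2 * j + 3) (L (M + 2 * j + 1) y)) := by rw [ih, hup, hdown]
      _ = L (M + 2 * j + 3) (L (M + 2 * j) (L (M + 2 * j + 1) y)) :=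
        hL _ _ (by lia) (by lia) _
      _ = L (M + 2 * j + 3) (L (M + 2 * j + 1) (L (M + 2 * j) y)) :=
        congrArg _ (hL _ _ (by lia) (by lia) y)

variable (hM : 1 ≤ M) (hmove : ∀ n w, dist (L n w) w ≤ (1 / 2) ^ n)

include hM hmove

lemma dist_compBelow_reorder_le (i : ℕ) (w : Torus) :
    dist (compBelow (fun k => L (ρ k)) (M + 1 + i) w) (compBelow L (M + 1 + i) w) ≤
      4 * (1 / 2) ^ i := by
  have hmove' : ∀ n, i ≤ n → ∀ v, dist (L n v) v ≤ (1 / 2) ^ i := fun n hn v =>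
    (hmove n v).trans (pow_le_pow_of_le_one (by norm_num) (by norm_num) hn)
  have hmove₂ : ∀ m n, i ≤ m → i ≤ n → ∀ v, dist (L m (L n v)) v ≤ 2 * (1 / 2) ^ i :=
    fun m n hm hn v => by
      linarith [dist_triangle (L m (L n v)) (L n v) v, hmove' m hm (L n v), hmove' n hn v]
  have hpos : (0 : ℝ) < (1 / 2) ^ i := by positivity
  rcases Nat.even_or_odd' i with ⟨j, hj | hj⟩
  · rw [show M + 1 + i = M + 2 * j + 1 by lia, compBelow_reorder hL hbase hup hdown]
    set y := compBelow L (M + 2 * j) w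
    change dist (L (M + 2 * j + 1) y) (L (M + 2 * j) y) ≤ _
    linarith [dist_triangle_right (L (M + 2 * j + 1) y) (L (M + 2 * j) y) y,
      hmove' (M + 2 * j + 1) (by lia) y, hmove' (M + 2 * j) (by lia) y]
  · rw [show M + 1 + i = M + 2 * j + 1 + 1 by lia]
    change dist (L (ρ (M + 2 * j + 1)) (compBelow (fun k => L (ρ k)) (M + 2 * j + 1) w))
      (L (M + 2 * j + 1) (L (M + 2 * j) (compBelow L (M + 2 * j) w))) ≤ _
    rw [compBelow_reorder hL hbase hup hdown, hup]
    set y := compBelow L (M + 2 * j) w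
    linarith [dist_triangle_right (L (M + 2 * j + 3) (L (M + 2 * j + 1) y))
        (L (M + 2 * j + 1) (L (M + 2 * j) y)) y,
      hmove₂ (M + 2 * j + 3) (M + 2 * j + 1) (by lia) (by lia) y,
      hmove₂ (M + 2 * j + 1) (M + 2 * j) (by lia) (by lia) y]

lemma tendstoUniformly_compBelow_reorder {Φ : Torus → Torus}
    (hΦ : TendstoUniformly (compBelow L) Φ atTop) :
    TendstoUniformly (compBelow fun k => L (ρ k)) Φ atTop := by
  refine Metric.tendstoUniformly_iff.2 fun η hη => ?_
  have hpow : Tendsto (fun i : ℕ => 4 * (1 / 2 : ℝ) ^ i) atTop (𝓝 0) := by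
    simpa using (tendsto_pow_atTop_nhds_zero_of_lt_one (r := (1 / 2 : ℝ)) (by norm_num)
      (by norm_num)).const_mul 4
  filter_upwards [(tendsto_sub_atTop_nat (M + 1)).eventually
      (hpow.eventually (gt_mem_nhds (half_pos hη))),
    Metric.tendstoUniformly_iff.1 hΦ _ (half_pos hη), eventually_ge_atTop (M + 1)]
    with n hn hn' hMn w
  have hdist := dist_compBelow_reorder_le hL hbase hup hdown hM hmove (n - (M + 1)) w
  rw [Nat.add_sub_cancel' hMn] at hdist
  linarith [dist_triangle_right (Φ w) (compBelow (fun k => L (ρ k)) n w) (compBelow L n w), hn' w]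

end Shift

variable (hL : ∀ j k, j ≤ k + 3 → k ≤ j + 3 → Function.Commute (L j) (L k))
  (hmove : ∀ n w, dist (L n w) w ≤ (1 / 2) ^ n) {Φ : Torus → Torus}
  (hΦ : TendstoUniformly (compBelow L) Φ atTop)

include hL hmove hΦ

lemma tendstoUniformly_compBelow_sigma :
    TendstoUniformly (compBelow fun k => L (sigma k)) Φ atTop := by
  refine tendstoUniformly_compBelow_reorder (ρ := sigma) (M := 1) hL
    (fun w => hL 0 2 (by lia) (by lia) w) ?_ ?_ le_rfl hmove hΦ
  all_goals
    unfold sigma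
    grind

lemma tendstoUniformly_compBelow_tau :
    TendstoUniformly (compBelow fun k => L (tau k)) Φ atTop := by
  refine tendstoUniformly_compBelow_reorder (ρ := tau) (M := 2) hL (fun w => ?_) ?_ ?_
    one_le_two hmove hΦ
  · change L 0 (L 3 (L 1 w)) = L 3 (L 1 (L 0 w))
    rw [(hL 0 3 (by lia) (by lia)).eq, (hL 0 1 (by lia) (by lia)).eq]
  all_goals
    unfold tau
    grind

end Reorder

/-! ### Uniform limits -/

lemma exists_tendstoUniformlyOn_of_dist_le_geometric {X E : Type*} [MetricSpace E]
    [CompleteSpace E] {F : ℕ → X → E} {s : Set X} {r : ℝ} (hr₀ : 0 ≤ r) (hr : r < 1)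
    (h : ∀ n, ∀ x ∈ s, dist (F n x) (F (n + 1) x) ≤ r ^ n) :
    ∃ G : X → E, TendstoUniformlyOn F G atTop s := by
  have h' : ∀ x ∈ s, ∀ n, dist (F n x) (F (n + 1) x) ≤ 1 * r ^ n := fun x hx n => by
    rw [one_mul]
    exact h n x hx
  have hlim : ∀ x, ∃ y, x ∈ s → Tendsto (fun n => F n x) atTop (𝓝 y) := by
    intro x
    by_cases hx : x ∈ s
    · obtain ⟨y, hy⟩ := cauchySeq_tendsto_of_complete (cauchySeq_of_le_geometric r 1 hr (h' x hx))
      exact ⟨y, fun _ => hy⟩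
    · exact ⟨F 0 x, fun hx' => absurd hx' hx⟩
  choose G hG using hlim
  refine ⟨G, Metric.tendstoUniformlyOn_iff.2 fun η hη => ?_⟩
  have htail : Tendsto (fun n : ℕ => 1 * r ^ n / (1 - r)) atTop (𝓝 0) := by
    simpa using (tendsto_pow_atTop_nhds_zero_of_lt_one hr₀ hr).div_const (1 - r)
  filter_upwards [htail.eventually (gt_mem_nhds hη)] with n hn x hx
  rw [dist_comm]
  exact (dist_le_of_le_geometric_of_tendsto r 1 hr (h' x hx) (hG x hx) n).trans_lt hn

lemma exists_continuous_tendstoUniformlyOn_of_dense {E E' : Type*} [UniformSpace E]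
    [UniformSpace E'] [CompleteSpace E'] [T2Space E'] {F : ℕ → E → E'} {G : E → E'} {s : Set E}
    (hs : Dense s) (h : TendstoUniformlyOn F G atTop s) (hF : ∀ n, UniformContinuousOn (F n) s) :
    ∃ S : E → E', Continuous S ∧ TendstoUniformlyOn F S atTop s := by
  have hG : UniformContinuous (s.domRestrict G) := uniformContinuousOn_iff_restrict.1
    (h.uniformContinuousOn (Eventually.of_forall hF).frequently)
  exact ⟨hs.extend (s.domRestrict G), (hs.uniformContinuous_extend hG).continuous,
    h.congr_right fun x hx => (hs.extend_of_ind hG ⟨x, hx⟩).symm⟩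

lemma semiconj_of_tendstoUniformly {E : Type*} [UniformSpace E] [T2Space E]
    {F Ψ C : ℕ → E → E} {S Φ R : E → E} {s : Set E} (hs : Dense s)
    (hF : TendstoUniformlyOn F S atTop s) (hΨ : TendstoUniformly Ψ Φ atTop)
    (hC : TendstoUniformly C Φ atTop) (hΦ : Continuous Φ) (hS : Continuous S) (hR : Continuous R)
    (h : ∀ n, ∀ w ∈ s, Ψ n (F n w) = R (C n w)) : Function.Semiconj Φ S R := by
  refine congrFun (Continuous.ext_on hs (hΦ.comp hS) (hR.comp hΦ) fun w hw => ?_)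
  have hleft : Tendsto (fun n => Ψ n (F n w)) atTop (𝓝 (Φ (S w))) :=
    hΨ.tendsto_comp hΦ.continuousAt (hF.tendsto_at hw)
  have hright : Tendsto (fun n => R (C n w)) atTop (𝓝 (R (Φ w))) :=
    (hR.tendsto _).comp (hC.tendsto_at w)
  exact tendsto_nhds_unique hleft (hright.congr fun n => (h n w hw).symm)

lemma surjective_of_tendstoUniformly {X E : Type*} [TopologicalSpace X] [CompactSpace X]
    [MetricSpace E] {F : ℕ → X → E} {Φ : X → E} (h : TendstoUniformly F Φ atTop)
    (hΦ : Continuous Φ) (hF : ∀ n, Function.Surjective (F n)) : Function.Surjective Φ := by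
  intro y
  rw [← mem_range, ← (isCompact_range hΦ).isClosed.closure_eq, Metric.mem_closure_iff]
  intro η hη
  obtain ⟨n, hn⟩ := (Metric.tendstoUniformly_iff.1 h η hη).exists
  obtain ⟨x, rfl⟩ := hF n y
  exact ⟨Φ x, mem_range_self x, by rw [dist_comm]; exact hn x⟩

/-! ### The infinite product -/

lemma prod_one_sub_inv_sq {n m : ℕ} (h : n ≤ m) :
    ∏ r ∈ Finset.Icc (n + 1) m, (1 - 1 / (((r + 2) ^ 2 : ℕ) : ℝ)) =
      (n + 2) / (n + 3) * ((m + 3) / (m + 2)) := by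
  induction m, h using Nat.le_induction with
  | base =>
    rw [Finset.Icc_eq_empty (by lia), Finset.prod_empty]
    field_simp
  | succ m h ih =>
    rw [Finset.prod_Icc_succ_top (by lia), ih]
    push_cast
    field_simp
    ring

lemma two_thirds_le_prod_one_sub_inv_sq {n m : ℕ} (h : n ≤ m) :
    2 / 3 ≤ ∏ r ∈ Finset.Icc (n + 1) m, (1 - 1 / (((r + 2) ^ 2 : ℕ) : ℝ)) := by
  rw [prod_one_sub_inv_sq h]
  have hn : (2 / 3 : ℝ) ≤ (n + 2) / (n + 3) := by
    rw [div_le_div_iff₀ (by norm_num) (by positivity)]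
    linarith [(Nat.cast_nonneg n : (0 : ℝ) ≤ n)]
  have hm : (1 : ℝ) ≤ (m + 3) / (m + 2) := by
    rw [le_div_iff₀ (by positivity)]
    linarith
  simpa using mul_le_mul hn hm zero_le_one (by positivity)

lemma tendsto_prod_one_sub_inv_sq :
    Tendsto (fun N : ℕ => ∏ r ∈ Finset.Icc 1 N, (1 - 1 / (((r + 2) ^ 2 : ℕ) : ℝ))) atTop
      (𝓝 (2 / 3)) := by
  have hlim : Tendsto (fun N : ℕ => (2 / 3 : ℝ) * (1 + 1 / ((N : ℝ) + 2))) atTop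
      (𝓝 (2 / 3 * (1 + 0))) :=
    (tendsto_const_nhds.add <| Tendsto.const_div_atTop
      (tendsto_atTop_add_const_right _ _ tendsto_natCast_atTop_atTop) _).const_mul _
  rw [add_zero, mul_one] at hlim
  refine hlim.congr fun N => ?_
  have hprod := prod_one_sub_inv_sq N.zero_le
  rw [zero_add] at hprod
  rw [hprod]
  push_cast
  field_simp
  ring

/-! ### Admissible sizes -/

/-- The property `P` holds for all sequences of positive sizes below some positive thresholds. -/
def HoldsBelowThresholds (P : (ℕ → ℝ) → Prop) : Prop :=
  ∃ ε : ℕ → ℝ, (∀ n, 0 < ε n) ∧ ∀ δ, (∀ n, δ n ∈ Ioo 0 (ε n)) → P δ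

lemma HoldsBelowThresholds.and {P Q : (ℕ → ℝ) → Prop} (hP : HoldsBelowThresholds P)
    (hQ : HoldsBelowThresholds Q) : HoldsBelowThresholds fun δ => P δ ∧ Q δ := by
  obtain ⟨ε, hε, h⟩ := hP
  obtain ⟨ε', hε', h'⟩ := hQ
  exact ⟨fun n => min (ε n) (ε' n), fun n => lt_min (hε n) (hε' n), fun δ hδ =>
    ⟨h δ fun n => Ioo_subset_Ioo_right (min_le_left _ _) (hδ n),
      h' δ fun n => Ioo_subset_Ioo_right (min_le_right _ _) (hδ n)⟩⟩

lemma HoldsBelowThresholds.mono {P Q : (ℕ → ℝ) → Prop} (hP : HoldsBelowThresholds P)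
    (h : ∀ δ, P δ → Q δ) : HoldsBelowThresholds Q := by
  obtain ⟨ε, hε, hPε⟩ := hP
  exact ⟨ε, hε, fun δ hδ => h δ (hPε δ hδ)⟩

lemma holdsBelowThresholds_smallSizes : HoldsBelowThresholds SmallSizes :=
  ⟨fun _ => 1 / 4, fun _ => by norm_num, fun _ hδ n => Ioo_subset_Ioc_self (hδ n)⟩

lemma holdsBelowThresholds_forall {P : ℕ → (ℕ → ℝ) → Prop}
    (h : ∀ n, ∃ ε > 0, ∀ δ, SmallSizes δ → δ n < ε → P n δ) :
    HoldsBelowThresholds fun δ => ∀ n, P n δ := by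
  choose ε hε h using h
  obtain ⟨ε', hε', hsmall⟩ := holdsBelowThresholds_smallSizes
  exact ⟨fun n => min (ε n) (ε' n), fun n => lt_min (hε n) (hε' n), fun δ hδ n =>
    h n δ (hsmall δ fun k => Ioo_subset_Ioo_right (min_le_right _ _) (hδ k))
      ((hδ n).2.trans_le (min_le_left _ _))⟩

/-- Sizes for which the compositions of `Λ` with the centres `z` converge uniformly and separate
points: neighbouring members of the family have disjoint supports, and the `n`-th one contracts
distant points by a factor `1 - 1 / (n + 2) ^ 2` at most. -/
structure Admissible (Λ : Torus → ℝ → Torus → Torus) (z : ℕ → Torus) (δ : ℕ → ℝ) : Prop where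
  small : SmallSizes δ
  two_mul_le : ∀ n, 2 * δ n ≤ (1 / 2) ^ n
  separated : ∀ n, ∀ j ≤ n + 3, j ≠ n → 4 * δ n ≤ ‖(z n).1 - (z j).1‖
  contract : ∀ (n : ℕ) (V W : Torus), 1 / ((n : ℝ) + 1) ≤ flatDist V W →
    (1 - 1 / (((n + 2) ^ 2 : ℕ) : ℝ)) * flatDist (pinchComp Λ z δ n V) (pinchComp Λ z δ n W) ≤
      flatDist (pinchComp Λ z δ (n + 1) V) (pinchComp Λ z δ (n + 1) W)

/-- Consecutive members of the sequence `Φ'_n⁻¹ ∘ Φ_n` on `X` have distance at most `(1 / 2) ^ n`,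
where `Φ'_n` is formed with the sizes `δ ∘ ρ` in place of `δ`. -/
def CauchyAlong (Λ : Torus → ℝ → Torus → Torus) (z : ℕ → Torus) (ρ : ℕ → ℕ) (δ : ℕ → ℝ) : Prop :=
  ∀ n, ∀ w ∈ offFibres z, ∀ A B : Torus,
    pinchComp Λ z (fun k => δ (ρ k)) n A = pinchComp Λ z δ n w →
    pinchComp Λ z (fun k => δ (ρ k)) (n + 1) B = pinchComp Λ z δ (n + 1) w →
    dist A B ≤ (1 / 2) ^ n

section Thresholds

variable {Λ : Torus → ℝ → Torus → Torus} {z : ℕ → Torus} (hΛ : IsPinching Λ)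
  (hz : Function.Injective fun n => (z n).1)

include hΛ hz

lemma holdsBelowThresholds_admissible : HoldsBelowThresholds (Admissible Λ z) := by
  have hpow : HoldsBelowThresholds fun δ => ∀ n, 2 * δ n ≤ (1 / 2) ^ n :=
    holdsBelowThresholds_forall fun n =>
      ⟨(1 / 2) ^ n / 2, by positivity, fun δ _ h => by linarith⟩
  have hsep : HoldsBelowThresholds fun δ => ∀ n, ∀ j ≤ n + 3, j ≠ n →
      4 * δ n ≤ ‖(z n).1 - (z j).1‖ :=
    holdsBelowThresholds_forall fun n => by
      obtain ⟨g, hg, hgap⟩ := exists_gap hz n (n + 4)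
      exact ⟨g / 4, by positivity, fun δ _ h j hj hjn => by linarith [hgap j (by lia) hjn]⟩
  have hcontract := holdsBelowThresholds_forall fun n =>
    exists_separation_threshold hΛ hz n (s := 1 / ((n : ℝ) + 1))
      (b := 1 / (((n + 2) ^ 2 : ℕ) : ℝ)) (by positivity) (by positivity)
  exact (holdsBelowThresholds_smallSizes.and (hpow.and (hsep.and hcontract))).mono
    fun δ ⟨h₁, h₂, h₃, h₄⟩ => ⟨h₁, h₂, h₃, h₄⟩

lemma holdsBelowThresholds_cauchyAlong {ρ ρ' : ℕ → ℕ} (hρ : Function.LeftInverse ρ' ρ) :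
    HoldsBelowThresholds (CauchyAlong Λ z ρ) := by
  choose ε hε h using fun n =>
    exists_cauchy_threshold hΛ hz n (show (0 : ℝ) < (1 / 2) ^ n by positivity)
  obtain ⟨ε', hε', hsmall⟩ := holdsBelowThresholds_smallSizes
  refine ⟨fun n => min (ε' n) (min (ε n) (ε (ρ' n))),
    fun n => lt_min (hε' n) (lt_min (hε n) (hε _)), fun δ hδ n w hw A B hA hB => ?_⟩
  have hδs : SmallSizes δ := hsmall δ fun k => Ioo_subset_Ioo_right (min_le_left _ _) (hδ k)
  have hlt : ∀ k, δ k < ε k ∧ δ k < ε (ρ' k) := fun k =>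
    lt_min_iff.1 ((hδ k).2.trans_le (min_le_right _ _))
  exact (h n δ (fun k => δ (ρ k)) hδs (fun k => hδs (ρ k)) (hlt n).1
    (by simpa only [hρ n] using (hlt (ρ n)).2) w hw A B hA hB).le

end Thresholds

lemma HoldsBelowThresholds.exists_flatDiam_threshold {P : (ℕ → ℝ) → Prop}
    (hP : HoldsBelowThresholds P) (z : ℕ → Torus) :
    ∃ ε : ℕ → ℝ, (∀ n, 0 < ε n) ∧ ∀ δ : ℕ → ℝ, (∀ n, 0 < δ n) →
      (∀ n, flatDiam (square (z n) (δ n)) < ε n) → P δ := by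
  obtain ⟨ε, hε, h⟩ := hP
  refine ⟨fun n => min (ε n) (1 / 2), fun n => lt_min (hε n) (by norm_num), fun δ hδ hdiam =>
    h δ fun n => ⟨hδ n, ?_⟩⟩
  exact (lt_of_flatDiam_square_lt (hδ n) (min_le_right _ _) (hdiam n)).trans_le (min_le_left _ _)

/-! ### The limit `Φ` -/

lemma apply_eq_of_limit_eq {F : ℕ → Torus → Torus} {Φ : Torus → Torus}
    (hF : TendstoUniformly F Φ atTop) {C : ℝ} (hC : 0 < C) {n : ℕ} {v w : Torus}
    (h : ∀ m ≥ n, C * flatDist (F n v) (F n w) ≤ flatDist (F m v) (F m w)) (hvw : Φ v = Φ w) :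
    F n v = F n w := by
  by_contra hne
  have hlim : Tendsto (fun m => flatDist (F m v) (F m w)) atTop (𝓝 (flatDist (Φ v) (Φ w))) :=
    Tendsto.comp (g := fun p : Torus × Torus => flatDist p.1 p.2) (f := fun m => (F m v, F m w))
      (continuous_flatDist.tendsto (Φ v, Φ w))
      ((hF.tendsto_at v).prodMk_nhds (hF.tendsto_at w))
  have hle := ge_of_tendsto hlim ((eventually_ge_atTop n).mono h)
  rw [hvw, flatDist_self] at hle
  linarith [mul_pos hC (flatDist_pos hne)]

section Limit

variable {Λ : Torus → ℝ → Torus → Torus} {z : ℕ → Torus} {δ : ℕ → ℝ} (hΛ : IsPinching Λ)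
  (hδ : Admissible Λ z δ)

include hδ

lemma Admissible.prod_mul_flatDist_le {n m : ℕ} (hn : 1 ≤ n) (hm : n ≤ m) {v w : Torus}
    (hvw : 1 / (n : ℝ) ≤ flatDist v w) :
    (∏ r ∈ Finset.Icc (n + 1) m, (1 - 1 / (((r + 2) ^ 2 : ℕ) : ℝ))) *
        flatDist (pinchComp Λ z δ (n + 1) v) (pinchComp Λ z δ (n + 1) w) ≤
      flatDist (pinchComp Λ z δ (m + 1) v) (pinchComp Λ z δ (m + 1) w) := by
  induction m, hm using Nat.le_induction with
  | base => rw [Finset.Icc_eq_empty (by lia), Finset.prod_empty, one_mul]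
  | succ m hm ih =>
    rw [Finset.prod_Icc_succ_top (by lia), mul_right_comm, mul_comm]
    have hfactor : (0 : ℝ) ≤ 1 - 1 / (((m + 1 + 2) ^ 2 : ℕ) : ℝ) :=
      sub_nonneg.2 (div_le_one_of_le₀ (by exact_mod_cast Nat.one_le_pow _ _ (by lia))
        (by positivity))
    have hdist : 1 / (((m + 1 : ℕ) : ℝ) + 1) ≤ flatDist v w := by
      refine le_trans (one_div_le_one_div_of_le (by exact_mod_cast hn) ?_) hvw
      exact_mod_cast (by lia : n ≤ m + 1 + 1)
    exact (mul_le_mul_of_nonneg_left ih hfactor).trans (hδ.contract (m + 1) v w hdist)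

include hΛ

lemma Admissible.dist_apply_le (n : ℕ) (w : Torus) : dist (Λ (z n) (δ n) w) w ≤ (1 / 2) ^ n :=
  (hΛ.dist_apply_le (hδ.small n) _ _).trans (hδ.two_mul_le n)

lemma Admissible.commute {j k : ℕ} (hjk : j ≤ k + 3) (hkj : k ≤ j + 3) :
    Function.Commute (Λ (z j) (δ j)) (Λ (z k) (δ k)) := by
  intro w
  rcases eq_or_ne j k with rfl | hne
  · rfl
  by_cases hj : δ j ≤ ‖w.1 - (z j).1‖
  · rw [hΛ.apply_of_le (w := w) (hδ.small j) hj,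
      hΛ.apply_of_le (hδ.small j) (by rwa [hΛ.apply_fst])]
  by_cases hk : δ k ≤ ‖w.1 - (z k).1‖
  · rw [hΛ.apply_of_le (w := w) (hδ.small k) hk,
      hΛ.apply_of_le (hδ.small k) (by rwa [hΛ.apply_fst])]
  have hsep_j := hδ.separated j k hkj hne.symm
  have hsep_k := hδ.separated k j hjk hne
  rw [norm_sub_rev] at hsep_k
  have htri := norm_sub_le_norm_sub_add_norm_sub (z j).1 w.1 (z k).1
  rw [norm_sub_rev (z j).1 w.1] at htri
  linarith [(hδ.small j).1, (hδ.small k).1]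

lemma Admissible.exists_tendstoUniformly :
    ∃ Φ, TendstoUniformly (pinchComp Λ z δ) Φ atTop := by
  obtain ⟨Φ, hΦ⟩ := exists_tendstoUniformlyOn_of_dist_le_geometric (F := pinchComp Λ z δ)
    (s := univ) (r := 1 / 2) (by norm_num) (by norm_num) fun n w _ => by
      rw [dist_comm]
      exact hδ.dist_apply_le hΛ n _
  exact ⟨Φ, tendstoUniformlyOn_univ.1 hΦ⟩

lemma Admissible.pinchComp_eq_center_of_le {n m : ℕ} (hnm : n + 1 ≤ m) {w : Torus}
    (h : pinchComp Λ z δ (n + 1) w = z n) : pinchComp Λ z δ m w = z n := by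
  induction m, hnm using Nat.le_induction with
  | base => exact h
  | succ m hm ih =>
    rw [pinchComp_succ, ih]
    refine hΛ.apply_of_le (hδ.small m) ?_
    rw [norm_sub_rev]
    linarith [hδ.separated m n (by lia) (by lia), (hδ.small m).1]

variable {Φ : Torus → Torus} (hΦ : TendstoUniformly (pinchComp Λ z δ) Φ atTop)

include hΦ

lemma Admissible.continuous_limit : Continuous Φ :=
  hΦ.continuous (Eventually.of_forall (continuous_pinchComp hΛ hδ.small)).frequently

lemma Admissible.surjective_limit : Function.Surjective Φ :=
  surjective_of_tendstoUniformly hΦ (hδ.continuous_limit hΛ hΦ) fun n w =>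
    (exists_pinchComp_eq hΛ hδ.small n w).imp fun _ h => h.2

lemma Admissible.limit_eq_center {n : ℕ} {w : Torus} (h : pinchComp Λ z δ (n + 1) w = z n) :
    Φ w = z n :=
  tendsto_nhds_unique (hΦ.tendsto_at w) <| tendsto_const_nhds.congr' <|
    (eventually_ge_atTop (n + 1)).mono fun _ hm => (hδ.pinchComp_eq_center_of_le hΛ hm h).symm

omit hδ in
lemma IsPinching.limit_fst (w : Torus) : (Φ w).1 = w.1 :=
  tendsto_nhds_unique ((continuous_fst.tendsto (Φ w)).comp (hΦ.tendsto_at w)) <|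
    tendsto_const_nhds.congr fun n => (pinchComp_fst hΛ n w).symm

omit hΛ in
lemma Admissible.exists_pinchComp_eq_of_limit_eq {v w : Torus} (hvw : v ≠ w) (h : Φ v = Φ w) :
    ∃ n, pinchComp Λ z δ n v = pinchComp Λ z δ n w := by
  obtain ⟨N, hN⟩ := exists_nat_one_div_lt (flatDist_pos hvw)
  rw [← Nat.cast_add_one] at hN
  refine ⟨N + 1 + 1, apply_eq_of_limit_eq hΦ (C := 2 / 3) (by norm_num) (fun m hm => ?_) h⟩
  obtain ⟨m, rfl⟩ := Nat.exists_eq_add_of_le' (Nat.le_of_add_left_le hm)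
  have hm' : N + 1 ≤ m := Nat.le_of_add_le_add_right hm
  exact (mul_le_mul_of_nonneg_right (two_thirds_le_prod_one_sub_inv_sq hm')
    (flatDist_nonneg _ _)).trans (hδ.prod_mul_flatDist_le N.succ_pos hm' hN.le)

lemma Admissible.exists_limit_eq_center {v w : Torus} (hvw : v ≠ w) (h : Φ v = Φ w) :
    ∃ n, Φ v = z n := by
  obtain ⟨N, hN⟩ := hδ.exists_pinchComp_eq_of_limit_eq hΦ hvw h
  obtain ⟨n, hn⟩ := exists_pinchComp_eq_center hΛ hδ.small hvw hN
  exact ⟨n, hδ.limit_eq_center hΛ hΦ hn⟩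

lemma Admissible.bijOn_limit : BijOn Φ (offFibres z) (offFibres z) := by
  have hfst := hΛ.limit_fst hΦ
  refine ⟨fun w hw => (mem_offFibres_congr (hfst w)).2 hw, fun v hv w _ h => ?_, fun w hw => ?_⟩
  · by_contra hvw
    obtain ⟨n, hn⟩ := hδ.exists_limit_eq_center hΛ hΦ hvw h
    exact hv n (by rw [← hfst v, hn])
  · obtain ⟨v, rfl⟩ := hδ.surjective_limit hΛ hΦ w
    exact ⟨v, (mem_offFibres_congr (hfst v)).1 hw, rfl⟩

lemma Admissible.not_existsUnique_limit_eq_iff (y : Torus) :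
    (¬∃! w, Φ w = y) ↔ ∃ n, y = z n := by
  constructor
  · intro h
    obtain ⟨v, rfl⟩ := hδ.surjective_limit hΛ hΦ y
    by_contra hne
    refine h ⟨v, rfl, fun w hw => ?_⟩
    by_contra hwv
    exact hne (hw ▸ hδ.exists_limit_eq_center hΛ hΦ hwv hw)
  · rintro ⟨n, rfl⟩ h
    obtain ⟨v, w, hne, hv, hw⟩ := exists_ne_pinchComp_eq_center (z := z) hΛ hδ.small n
    exact hne (h.unique (hδ.limit_eq_center hΛ hΦ hv) (hδ.limit_eq_center hΛ hΦ hw))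

lemma Admissible.tendstoUniformly_sigma :
    TendstoUniformly (pinchComp Λ (fun k => z (sigma k)) fun k => δ (sigma k)) Φ atTop :=
  tendstoUniformly_compBelow_sigma (L := fun k => Λ (z k) (δ k))
    (fun _ _ => hδ.commute hΛ) (hδ.dist_apply_le hΛ) hΦ

lemma Admissible.tendstoUniformly_tau :
    TendstoUniformly (pinchComp Λ (fun k => z (tau k)) fun k => δ (tau k)) Φ atTop :=
  tendstoUniformly_compBelow_tau (L := fun k => Λ (z k) (δ k))
    (fun _ _ => hδ.commute hΛ) (hδ.dist_apply_le hΛ) hΦ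

end Limit

/-! ### The homeomorphism `S` -/

lemma apply_conjOn {X : Set Torus} {G R F : Torus → Torus} (hG : SurjOn G X X) (hR : MapsTo R X X)
    (hF : MapsTo F X X) {w : Torus} (hw : w ∈ X) : G (conjOn X G R F w) = R (F w) :=
  Function.invFunOn_eq (hG (hR (hF hw)))

/-- The map `Φ'_n⁻¹ ∘ rot e ∘ Φ_n` on `X`, where `Φ_n` composes the first `n` members of the family
and `Φ'_n` those with the indices `ρ 0, …, ρ (n - 1)`. -/
def shiftConj (Λ : Torus → ℝ → Torus → Torus) (z : ℕ → Torus) (δ : ℕ → ℝ) (e : Torus) (ρ : ℕ → ℕ)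
    (n : ℕ) : Torus → Torus :=
  conjOn (offFibres z) (pinchComp Λ (fun k => z (ρ k)) (fun k => δ (ρ k)) n) (rot e)
    (pinchComp Λ z δ n)

section Shift

variable {Λ : Torus → ℝ → Torus → Torus} {z : ℕ → Torus} {δ : ℕ → ℝ} {e : Torus} {ρ : ℕ → ℕ}
  (h : IsShift z e ρ) (hΛ : IsPinching Λ)

include h

lemma IsShift.mapsTo_of_semiconj {Φ S : Torus → Torus} (hΦ : ∀ w, (Φ w).1 = w.1)
    (hS : Function.Semiconj Φ S (rot e)) : MapsTo S (offFibres z) (offFibres z) := by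
  intro w hw
  refine (mem_offFibres_congr ?_).1 (h.mapsTo_offFibres ((mem_offFibres_congr (hΦ w)).2 hw))
  rw [← hS w, hΦ]

include hΛ

lemma IsShift.bijOn_pinchComp_comp (hδ : SmallSizes δ) (n : ℕ) :
    BijOn (pinchComp Λ (fun k => z (ρ k)) (fun k => δ (ρ k)) n) (offFibres z) (offFibres z) := by
  rw [← h.offFibres_comp]
  exact bijOn_pinchComp hΛ (fun k => hδ (ρ k)) n

lemma IsShift.pinchComp_shiftConj (hδ : SmallSizes δ) (n : ℕ) {w : Torus} (hw : w ∈ offFibres z) :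
    pinchComp Λ (fun k => z (ρ k)) (fun k => δ (ρ k)) n (shiftConj Λ z δ e ρ n w) =
      rot e (pinchComp Λ z δ n w) :=
  apply_conjOn (h.bijOn_pinchComp_comp hΛ hδ n).surjOn h.mapsTo_offFibres
    (bijOn_pinchComp hΛ hδ n).mapsTo hw

lemma IsShift.pinchComp_shiftConj_sub (hδ : SmallSizes δ) (n : ℕ) {w : Torus}
    (hw : w ∈ offFibres z) :
    pinchComp Λ z (fun k => δ (ρ k)) n (shiftConj Λ z δ e ρ n w - e) = pinchComp Λ z δ n w := by
  have hz : (fun k => z k + e) = fun k => z (ρ k) := funext h.rot_apply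
  apply add_right_cancel (b := e)
  rw [← pinchComp_add hΛ, sub_add_cancel, hz]
  exact h.pinchComp_shiftConj hΛ hδ n hw

lemma IsShift.uniformContinuousOn_shiftConj (hδ : Admissible Λ z δ) (hz : Function.Injective z)
    (n : ℕ) : UniformContinuousOn (shiftConj Λ z δ e ρ n) (offFibres z) := by
  have hgap : ∀ n, ∀ k < n, 4 * δ (ρ n) ≤ ‖(z n).1 - (z k).1‖ := fun n k hk => by
    have hsep := hδ.separated (ρ n) (ρ k) (h.le_add_three hk) ((h.injective hz).ne hk.ne)
    rw [← h.rot_apply n, ← h.rot_apply k] at hsep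
    change 4 * δ (ρ n) ≤ ‖(z n).1 + e.1 - ((z k).1 + e.1)‖ at hsep
    rwa [add_sub_add_right_eq_sub] at hsep
  refine Metric.uniformContinuousOn_iff.2 fun η hη => ?_
  obtain ⟨κ, hκ, hdist⟩ := pinchComp_symm_comp_equicontinuous hΛ hδ.small
    (fun k => hδ.small (ρ k)) (fun n k hk => hδ.separated n k (by lia) hk.ne) hgap n hη
  refine ⟨κ, hκ, fun V hV W hW hVW => ?_⟩
  rw [← dist_sub_right _ _ e]
  exact hdist V hV W hW _ _ (h.pinchComp_shiftConj_sub hΛ hδ.small n hV)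
    (h.pinchComp_shiftConj_sub hΛ hδ.small n hW) hVW

lemma IsShift.exists_semiconj (hδ : Admissible Λ z δ) (hz : Function.Injective z)
    (hC : CauchyAlong Λ z ρ δ) {Φ : Torus → Torus}
    (hΦ : TendstoUniformly (pinchComp Λ z δ) Φ atTop)
    (hΦρ : TendstoUniformly (pinchComp Λ (fun k => z (ρ k)) fun k => δ (ρ k)) Φ atTop) :
    ∃ S, Continuous S ∧ TendstoUniformlyOn (shiftConj Λ z δ e ρ) S atTop (offFibres z) ∧
      Function.Semiconj Φ S (rot e) := by
  obtain ⟨G, hG⟩ := exists_tendstoUniformlyOn_of_dist_le_geometric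
    (F := shiftConj Λ z δ e ρ) (s := offFibres z) (r := 1 / 2) (by norm_num) (by norm_num)
    fun n w hw => by
      rw [← dist_sub_right _ _ e]
      exact hC n w hw _ _ (h.pinchComp_shiftConj_sub hΛ hδ.small n hw)
        (h.pinchComp_shiftConj_sub hΛ hδ.small (n + 1) hw)
  obtain ⟨S, hS, hlim⟩ := exists_continuous_tendstoUniformlyOn_of_dense (dense_offFibres z) hG
    (h.uniformContinuousOn_shiftConj hΛ hδ hz)
  exact ⟨S, hS, hlim, semiconj_of_tendstoUniformly (dense_offFibres z) hlim hΦρ hΦ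
    (hδ.continuous_limit hΛ hΦ) hS (rot e).continuous
    fun n w hw => h.pinchComp_shiftConj hΛ hδ.small n hw⟩

end Shift

lemma leftInverse_of_semiconj {E : Type*} [TopologicalSpace E] [T2Space E] {X : Set E}
    {Φ R R' S S' : E → E} (hX : Dense X) (hΦ : InjOn Φ X) (hS : Continuous S)
    (hS' : Continuous S') (hSX : MapsTo S X X) (hSX' : MapsTo S' X X)
    (h : Function.Semiconj Φ S R) (h' : Function.Semiconj Φ S' R')
    (hR : Function.LeftInverse R' R) : Function.LeftInverse S' S :=
  congrFun <| Continuous.ext_on hX (hS'.comp hS) continuous_id fun w hw =>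
    hΦ (hSX' (hSX hw)) hw ((h' _).trans ((congrArg R' (h w)).trans (hR _)))

lemma eqOn_conjOn_of_semiconj {X : Set Torus} {Φ R S : Torus → Torus} (hΦ : InjOn Φ X)
    (hS : MapsTo S X X) (h : Function.Semiconj Φ S R) : EqOn S (conjOn X Φ R Φ) X := by
  intro w hw
  rw [conjOn, ← h w, hΦ.leftInvOn_invFunOn (hS hw)]

lemma Admissible.existsUnique_homeomorph {Λ : Torus → ℝ → Torus → Torus} {z : ℕ → Torus}
    {δ : ℕ → ℝ} (hδ : Admissible Λ z δ) (hΛ : IsPinching Λ) (hz : Function.Injective z)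
    {Φ : Torus → Torus} (hΦ : TendstoUniformly (pinchComp Λ z δ) Φ atTop) {e : Torus}
    {ρ ρ' : ℕ → ℕ} (h : IsShift z e ρ) (h' : IsShift z (-e) ρ') (hC : CauchyAlong Λ z ρ δ)
    (hC' : CauchyAlong Λ z ρ' δ)
    (hΦρ : TendstoUniformly (pinchComp Λ (fun k => z (ρ k)) fun k => δ (ρ k)) Φ atTop)
    (hΦρ' : TendstoUniformly (pinchComp Λ (fun k => z (ρ' k)) fun k => δ (ρ' k)) Φ atTop) :
    ∃! S : Torus ≃ₜ Torus,
      (∀ w ∈ offFibres z, S w = conjOn (offFibres z) Φ (rot e) Φ w) ∧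
      (∀ w, Φ (S w) = rot e (Φ w)) ∧
      TendstoUniformlyOn (fun n => shiftConj Λ z δ e ρ (n + 1)) S atTop (offFibres z) ∧
      TendstoUniformlyOn (fun n => shiftConj Λ z δ (-e) ρ' (n + 1)) S.symm atTop
        (offFibres z) := by
  obtain ⟨S, hS, hlim, hsemi⟩ := h.exists_semiconj hΛ hδ hz hC hΦ hΦρ
  obtain ⟨S', hS', hlim', hsemi'⟩ := h'.exists_semiconj hΛ hδ hz hC' hΦ hΦρ'
  have hfst := hΛ.limit_fst hΦ
  have hinj := (hδ.bijOn_limit hΛ hΦ).injOn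
  have hSX := h.mapsTo_of_semiconj hfst hsemi
  have hSX' := h'.mapsTo_of_semiconj hfst hsemi'
  rw [← rot_symm] at hsemi'
  let H : Torus ≃ₜ Torus :=
    { toFun := S
      invFun := S'
      left_inv := leftInverse_of_semiconj (dense_offFibres z) hinj hS hS' hSX hSX' hsemi hsemi'
        (rot e).symm_apply_apply
      right_inv := leftInverse_of_semiconj (dense_offFibres z) hinj hS' hS hSX' hSX hsemi' hsemi
        (rot e).apply_symm_apply }
  have hconj := eqOn_conjOn_of_semiconj hinj hSX hsemi
  refine ⟨H, ⟨hconj, hsemi, fun u hu => (tendsto_add_atTop_nat 1).eventually (hlim u hu),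
    fun u hu => (tendsto_add_atTop_nat 1).eventually (hlim' u hu)⟩, fun K hK => ?_⟩
  exact DFunLike.coe_injective <| Continuous.ext_on (dense_offFibres z) K.continuous hS
    fun w hw => (hK.1 w hw).trans (hconj hw).symm

section Paper

variable (D : StripData) (α : ℕ → ℝ) (c z₀ : Torus) (δ : ℕ → ℝ)

lemma phi_eq : phi D α c z₀ δ = fun n => pinchComp (lam D α) (orbitPt c z₀) δ (n + 1) :=
  funext (compUpTo_eq _)

lemma phiSigma_eq : phiSigma D α c z₀ δ = fun n =>
    pinchComp (lam D α) (fun k => orbitPt c z₀ (sigma k)) (fun k => δ (sigma k)) (n + 1) :=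
  funext (compUpTo_eq _)

lemma phiTau_eq : phiTau D α c z₀ δ = fun n =>
    pinchComp (lam D α) (fun k => orbitPt c z₀ (tau k)) (fun k => δ (tau k)) (n + 1) :=
  funext (compUpTo_eq _)

end Paper

end DenjoyRees

end

theorem mainTheorem4_general
    (c z₀ : Torus) (hc : ¬IsOfFinAddOrder c.1)
    (D : StripData) (α : ℕ → ℝ) (hα : ∀ k, α k ∈ Set.Icc (0 : ℝ) 1) :
    ∃ (a : ℕ → ℕ) (ε₁ ε₂ ε₃ : ℕ → ℝ),
      (∀ n, 2 ≤ a n) ∧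
      (∃ P : ℝ, 0 < P ∧
        Tendsto (fun N : ℕ => ∏ r ∈ Finset.Icc 1 N, (1 - 1 / (a r : ℝ))) atTop (𝓝 P)) ∧
      (∀ n, 0 < ε₁ n ∧ 0 < ε₂ n ∧ 0 < ε₃ n) ∧
      ∀ δ : ℕ → ℝ, (∀ n, 0 < δ n) →
        (∀ n, flatDiam (square (orbitPt c z₀ n) (δ n)) < ε₁ n ∧
          flatDiam (square (orbitPt c z₀ n) (δ n)) < ε₂ n ∧
          flatDiam (square (orbitPt c z₀ n) (δ n)) < ε₃ n) →
        (∀ n m : ℕ, 1 ≤ n → n < m → ∀ v w : Torus, 1 / (n : ℝ) ≤ flatDist v w →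
          (∏ r ∈ Finset.Icc (n + 1) m, (1 - 1 / (a r : ℝ))) *
              flatDist (phi D α c z₀ δ n v) (phi D α c z₀ δ n w) ≤
            flatDist (phi D α c z₀ δ m v) (phi D α c z₀ δ m w)) ∧
        (∀ n, Set.BijOn (phi D α c z₀ δ n) (goodSet c z₀) (goodSet c z₀) ∧
          Set.BijOn (phiSigma D α c z₀ δ n) (goodSet c z₀) (goodSet c z₀) ∧
          Set.BijOn (phiTau D α c z₀ δ n) (goodSet c z₀) (goodSet c z₀)) ∧
        (∀ n, UniformContinuousOn
          (conjOn (goodSet c z₀) (phiSigma D α c z₀ δ n) (rot c) (phi D α c z₀ δ n))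
          (goodSet c z₀)) ∧
        (∀ n, UniformContinuousOn
          (conjOn (goodSet c z₀) (phiTau D α c z₀ δ n) (rot c).symm (phi D α c z₀ δ n))
          (goodSet c z₀)) ∧
        UniformCauchySeqOn
          (fun n => conjOn (goodSet c z₀) (phiSigma D α c z₀ δ n) (rot c) (phi D α c z₀ δ n))
          atTop (goodSet c z₀) ∧
        UniformCauchySeqOn
          (fun n => conjOn (goodSet c z₀) (phiTau D α c z₀ δ n) (rot c).symm (phi D α c z₀ δ n))
          atTop (goodSet c z₀) ∧
        ∃ Φ : Torus → Torus,
          TendstoUniformly (phi D α c z₀ δ) Φ atTop ∧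
          Continuous Φ ∧ Function.Surjective Φ ∧ (∀ w, (Φ w).1 = w.1) ∧
          Set.BijOn Φ (goodSet c z₀) (goodSet c z₀) ∧
          (∀ z : Torus, (¬ ∃! w, Φ w = z) ↔ ∃ n, z = orbitPt c z₀ n) ∧
          ∃! S : Torus ≃ₜ Torus,
            (∀ w ∈ goodSet c z₀, S w = conjOn (goodSet c z₀) Φ (rot c) Φ w) ∧
            (∀ w, Φ (S w) = rot c (Φ w)) ∧
            TendstoUniformlyOn
              (fun n => conjOn (goodSet c z₀) (phiSigma D α c z₀ δ n) (rot c) (phi D α c z₀ δ n))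
              S atTop (goodSet c z₀) ∧
            TendstoUniformlyOn
              (fun n => conjOn (goodSet c z₀) (phiTau D α c z₀ δ n) (rot c).symm
                (phi D α c z₀ δ n))
              S.symm atTop (goodSet c z₀) := by
  have hΛ := isPinching_lam D hα
  have hz := orbitPt_fst_injective hc z₀
  have hsig := isShift_sigma c z₀
  have htau := isShift_tau c z₀
  obtain ⟨ε, hε, h⟩ := ((holdsBelowThresholds_admissible hΛ hz).and
    ((holdsBelowThresholds_cauchyAlong hΛ hz tau_leftInverse_sigma).and
      (holdsBelowThresholds_cauchyAlong hΛ hz sigma_leftInverse_tau))).exists_flatDiam_threshold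
    (orbitPt c z₀)
  refine ⟨fun n => (n + 2) ^ 2, ε, ε, ε, fun n =>
    (Nat.le_add_left 2 n).trans (Nat.le_self_pow two_ne_zero _), ⟨2 / 3, by norm_num,
    tendsto_prod_one_sub_inv_sq⟩, fun n => ⟨hε n, hε n, hε n⟩, fun δ hδpos hdiam => ?_⟩
  obtain ⟨hδ, hCsig, hCtau⟩ := h δ hδpos fun n => (hdiam n).1
  obtain ⟨Φ, hΦ⟩ := hδ.exists_tendstoUniformly hΛ
  have hS := hδ.existsUnique_homeomorph hΛ hz.of_comp hΦ hsig htau hCsig hCtau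
    (hδ.tendstoUniformly_sigma hΛ hΦ) (hδ.tendstoUniformly_tau hΛ hΦ)
  obtain ⟨S, -, -, hlim, hlim'⟩ := hS.exists
  rw [phi_eq, phiSigma_eq, phiTau_eq, rot_symm]
  exact ⟨fun n m hn hm v w => hδ.prod_mul_flatDist_le hn hm.le,
    fun n => ⟨bijOn_pinchComp hΛ hδ.small _, hsig.bijOn_pinchComp_comp hΛ hδ.small _,
      htau.bijOn_pinchComp_comp hΛ hδ.small _⟩,
    fun n => hsig.uniformContinuousOn_shiftConj hΛ hδ hz.of_comp _,
    fun n => htau.uniformContinuousOn_shiftConj hΛ hδ hz.of_comp _,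
    hlim.uniformCauchySeqOn, hlim'.uniformCauchySeqOn, Φ,
    fun u hu => (tendsto_add_atTop_nat 1).eventually (hΦ u hu), hδ.continuous_limit hΛ hΦ,
    hδ.surjective_limit hΛ hΦ, hΛ.limit_fst hΦ, hδ.bijOn_limit hΛ hΦ,
    hδ.not_existsUnique_limit_eq_iff hΛ hΦ, hS⟩

theorem mainTheorem4
    (c z₀ : Torus) (hT : IsMinimalHomeo (rot c))
    (D : StripData) (α : ℕ → ℝ) (hα : ∀ k, α k ∈ Set.Icc (0 : ℝ) 1) :
    ∃ (a : ℕ → ℕ) (ε₁ ε₂ ε₃ : ℕ → ℝ),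
      (∀ n, 2 ≤ a n) ∧
      (∃ P : ℝ, 0 < P ∧
        Tendsto (fun N : ℕ => ∏ r ∈ Finset.Icc 1 N, (1 - 1 / (a r : ℝ))) atTop (𝓝 P)) ∧
      (∀ n, 0 < ε₁ n ∧ 0 < ε₂ n ∧ 0 < ε₃ n) ∧
      ∀ δ : ℕ → ℝ, (∀ n, 0 < δ n) →
        (∀ n, flatDiam (square (orbitPt c z₀ n) (δ n)) < ε₁ n ∧
          flatDiam (square (orbitPt c z₀ n) (δ n)) < ε₂ n ∧
          flatDiam (square (orbitPt c z₀ n) (δ n)) < ε₃ n) →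
        -- the lower bound on the separation of points
        (∀ n m : ℕ, 1 ≤ n → n < m → ∀ v w : Torus, 1 / (n : ℝ) ≤ flatDist v w →
          (∏ r ∈ Finset.Icc (n + 1) m, (1 - 1 / (a r : ℝ))) *
              flatDist (phi D α c z₀ δ n v) (phi D α c z₀ δ n w) ≤
            flatDist (phi D α c z₀ δ m v) (phi D α c z₀ δ m w)) ∧
        -- the maps that are inverted below are bijections of `X`
        (∀ n, Set.BijOn (phi D α c z₀ δ n) (goodSet c z₀) (goodSet c z₀) ∧
          Set.BijOn (phiSigma D α c z₀ δ n) (goodSet c z₀) (goodSet c z₀) ∧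
          Set.BijOn (phiTau D α c z₀ δ n) (goodSet c z₀) (goodSet c z₀)) ∧
        -- the conjugated maps are uniformly continuous and uniformly Cauchy on `X`
        (∀ n, UniformContinuousOn
          (conjOn (goodSet c z₀) (phiSigma D α c z₀ δ n) (rot c) (phi D α c z₀ δ n))
          (goodSet c z₀)) ∧
        (∀ n, UniformContinuousOn
          (conjOn (goodSet c z₀) (phiTau D α c z₀ δ n) (rot c).symm (phi D α c z₀ δ n))
          (goodSet c z₀)) ∧
        UniformCauchySeqOn
          (fun n => conjOn (goodSet c z₀) (phiSigma D α c z₀ δ n) (rot c) (phi D α c z₀ δ n))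
          atTop (goodSet c z₀) ∧
        UniformCauchySeqOn
          (fun n => conjOn (goodSet c z₀) (phiTau D α c z₀ δ n) (rot c).symm (phi D α c z₀ δ n))
          atTop (goodSet c z₀) ∧
        -- the limit `Φ` and the homeomorphism `S`
        ∃ Φ : Torus → Torus,
          TendstoUniformly (phi D α c z₀ δ) Φ atTop ∧
          Continuous Φ ∧ Function.Surjective Φ ∧ (∀ w, (Φ w).1 = w.1) ∧
          Set.BijOn Φ (goodSet c z₀) (goodSet c z₀) ∧
          (∀ z : Torus, (¬ ∃! w, Φ w = z) ↔ ∃ n, z = orbitPt c z₀ n) ∧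
          ∃! S : Torus ≃ₜ Torus,
            (∀ w ∈ goodSet c z₀, S w = conjOn (goodSet c z₀) Φ (rot c) Φ w) ∧
            (∀ w, Φ (S w) = rot c (Φ w)) ∧
            TendstoUniformlyOn
              (fun n => conjOn (goodSet c z₀) (phiSigma D α c z₀ δ n) (rot c) (phi D α c z₀ δ n))
              S atTop (goodSet c z₀) ∧
            TendstoUniformlyOn
              (fun n => conjOn (goodSet c z₀) (phiTau D α c z₀ δ n) (rot c).symm
                (phi D α c z₀ δ n))
              S.symm atTop (goodSet c z₀) := by
  exact mainTheorem4_general c z₀ (not_isOfFinAddOrder_of_isMinimalHomeo hT) D α hα
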